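/- Setting. Let $\Omega$ be a compact metric space with a non-atomic Borel probability measure $m$; $B(x,r)$ denotes a ball with centre $x$ and radius $r>0$. Let $\{R_\alpha\subset\Omega:\alpha\in J\}$ be a family of subsets indexed by an infinite countable set $J$, and let $\beta:J\to(0,\infty)$, $\alpha\mapsto\beta_\alpha$, be such that $\{\alpha\in J:\beta_\alpha\le M\}$ is finite for every $M$. For $A\subset\Omega$ put $\Delta(A,\eta)=\{x\in\Omega:\mathrm{dist}(x,A)<\eta\}$. Let $\psi:(0,\infty)\to(0,\infty)$ be decreasing (not necessarily strictly), and let $$\Lambda(\psi)=\{x\in\Omega: x\in\Delta(R_\alpha,\psi(\beta_\alpha))\text{ for infinitely many }\alpha\in J\}.$$ Let $\rho:(0,\infty)\to(0,\infty)$ satisfy $\rho(r)\to0$ as $r\to\infty$, and let $l=(l_n)$, $u=(u_n)$ be positive increasing sequences with $l_n<u_n$ for all $n$ and $l_n\to\infty$. Assume (M2): there are constants $\delta,a,b,r_0>0$ with $a\,r^\delta\le m(B(x,r))\le b\,r^\delta$ for all $x\in\Omega$ and $0<r\le r_0$. Assume that $(\{R_\alpha\},\beta)$ is a local $m$-ubiquitous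 system relative to $(\rho,l,u)$, with common dimension $\gamma$, that is: (a) there are $\kappa>0$ and $r_1>0$ such that for every ball $B=B(x,r)$ with $x\in\Omega$ and $0<r\le r_1$ there is $n_0(B)$ with $$m\Big(B\cap\bigcup_{\alpha\in J:\ l_n<\beta_\alpha\le u_n}\Delta(R_\alpha,\rho(u_n))\Big)\ge\kappa\,m(B)\qquad\text{for all }n\ge n_0(B);$$ (b) $0\le\gamma\le\dim\Omega$, and there are constants $c_1,c_2>0$ such that for all sufficiently large $n$, all $\alpha\in J$ with $\beta_\alpha\le u_n$, all $c\in R_\alpha$ and all $0<\lambda\le\rho(u_n)$, $$m\big(B(c,\tfrac12\rho(u_n))\cap\Delta(R_\alpha,\lambda)\big)\ge c_1\,m(B(c,\lambda))\Big(\frac{\rho(u_n)}{\lambda}\Big)^{\gamma},$$ $$m\big(B\cap B(c,3\rho(u_n))\cap\Delta(R_\alpha,3\lambda)\big)\le c_2\,m(B(c,\lambda))\Big(\frac{r(B)}{\lambda}\Big)^{\gamma}$$ for every ball $B$ of radius $r(B)\le3\rho(u_n)$ centred at a point of one of the sets $R_{\alpha'}$, $\alpha'\in J$. Write $\mathcal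 H^s$ for $s$-dimensional Hausdorff measure and $\dim$ for Hausdorff dimension. Conclusion. (i) If $\delta\ne\gamma$ and $\lim_{n\to\infty}\psi(u_n)/\rho(u_n)=0$, then $$\dim\Lambda(\psi)\ge d:=\gamma+\sigma(\delta-\gamma),\qquad\text{where }\ \sigma:=\limsup_{n\to\infty}\frac{\log\rho(u_n)}{\log\psi(u_n)}.$$ Moreover, if $\liminf_{n\to\infty}\rho(u_n)/\psi(u_n)^{\sigma}<\infty$, then $\mathcal H^{d}(\Lambda(\psi))=\infty$. (ii) If either $\delta=\gamma$ or $\limsup_{n\to\infty}\psi(u_n)/\rho(u_n)>0$, then $0<\mathcal H^{\delta}(\Lambda(\psi))<\infty$, and so $\dim\Lambda(\psi)=\delta$. -/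

import Mathlib

open Set Filter Topology MeasureTheory Metric

namespace Ubiquity

/-- An approximating function: a real, positive, decreasing (not necessarily strictly) function on
the positive reals. Values at non-positive arguments play no role. -/
structure IsApproximatingFunction (ψ : ℝ → ℝ) : Prop where
  pos : ∀ r, 0 < r → 0 < ψ r
  anti : AntitoneOn ψ (Ioi 0)

/-- The function in the definition of ubiquity: a positive function on the positive reals which
tends to zero at infinity. No monotonicity is assumed. -/
structure IsUbiquityFunction (ρ : ℝ → ℝ) : Prop where
  pos : ∀ r, 0 < r → 0 < ρ r
  tendsto_zero : Tendsto ρ atTop (𝓝 0)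

/-- A weight on the index set of the resonant sets: positive, and only finitely many indices
have weight below any given bound. -/
structure IsWeight {J : Type*} (β : J → ℝ) : Prop where
  pos : ∀ α, 0 < β α
  finite_le : ∀ M : ℝ, {α | β α ≤ M}.Finite

/-- `l` is a lower sequence and `u` an upper sequence: positive increasing sequences with
`l n < u n` for all `n` and `l n → ∞`. -/
structure IsLowerUpper (l u : ℕ → ℝ) : Prop where
  lower_pos : ∀ n, 0 < l n
  upper_pos : ∀ n, 0 < u n
  lower_mono : Monotone l
  upper_mono : Monotone u
  lt : ∀ n, l n < u n
  lower_tendsto : Tendsto l atTop atTop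

variable {Ω : Type*} [MetricSpace Ω] {J : Type*}

/-- The limsup set `Λ(ψ)`: the points lying in the open `ψ(β_α)`-neighbourhood of the resonant
set `R_α` for infinitely many indices `α`. -/
def limsupSet (R : J → Set Ω) (β : J → ℝ) (ψ : ℝ → ℝ) : Set Ω :=
  {x | {α | x ∈ thickening (ψ (β α)) (R α)}.Infinite}

/-- The index block `J_l^u(n)` of all `α` with `l_n < β_α ≤ u_n`. -/
def indexBlock (β : J → ℝ) (l u : ℕ → ℝ) (n : ℕ) : Set J :=
  {α | l n < β α ∧ β α ≤ u n}

/-- The set `Δ_l^u(ρ, n)`: the union over `α ∈ J_l^u(n)` of the `ρ(u_n)`-neighbourhoods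
of `R_α`. -/
def ubiquityUnion (R : J → Set Ω) (β : J → ℝ) (ρ : ℝ → ℝ) (l u : ℕ → ℝ) (n : ℕ) : Set Ω :=
  ⋃ α ∈ indexBlock β l u n, thickening (ρ (u n)) (R α)

variable [MeasurableSpace Ω]

/-- Condition (M2) with exponent `δ > 0`: the measure of every ball of small radius `r` is
comparable to `r ^ δ`, uniformly in the centre. -/
def ConditionM2 (m : Measure Ω) (δ : ℝ) : Prop :=
  0 < δ ∧ ∃ a b r₀ : ℝ, 0 < a ∧ 0 < b ∧ 0 < r₀ ∧
    ∀ (x : Ω) (r : ℝ), 0 < r → r ≤ r₀ →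
      a * r ^ δ ≤ m.real (ball x r) ∧ m.real (ball x r) ≤ b * r ^ δ

/-- The intersection conditions with common dimension `γ`, where `0 ≤ γ ≤ dim Ω`. The threshold
`n₀` and the constants `c₁`, `c₂` are uniform in `α`, in the centre `c`, in the thickness `t`
and in the ball `ball x r` (an arbitrary ball centred on some resonant set). -/
def IntersectionConditions (m : Measure Ω) (R : J → Set Ω) (β : J → ℝ) (ρ : ℝ → ℝ)
    (u : ℕ → ℝ) (γ : ℝ) : Prop :=
  0 ≤ γ ∧ ENNReal.ofReal γ ≤ dimH (univ : Set Ω) ∧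
    ∃ c₁ c₂ : ℝ, 0 < c₁ ∧ 0 < c₂ ∧ ∃ n₀ : ℕ, ∀ n, n₀ ≤ n →
      ∀ α, β α ≤ u n → ∀ c ∈ R α, ∀ t : ℝ, 0 < t → t ≤ ρ (u n) →
        c₁ * m.real (ball c t) * (ρ (u n) / t) ^ γ
            ≤ m.real (ball c (ρ (u n) / 2) ∩ thickening t (R α)) ∧
        ∀ α', ∀ x ∈ R α', ∀ r : ℝ, 0 < r → r ≤ 3 * ρ (u n) →
          m.real (ball x r ∩ ball c (3 * ρ (u n)) ∩ thickening (3 * t) (R α))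
            ≤ c₂ * m.real (ball c t) * (r / t) ^ γ

/-- `(R, β)` is a local `m`-ubiquitous system relative to `(ρ, l, u)`, with common dimension `γ`
of the resonant sets. The constant `κ` is absolute, while the threshold `n₀` may depend on the
ball. -/
def IsLocallyUbiquitous (m : Measure Ω) (R : J → Set Ω) (β : J → ℝ) (ρ : ℝ → ℝ)
    (l u : ℕ → ℝ) (γ : ℝ) : Prop :=
  (∃ κ r₀ : ℝ, 0 < κ ∧ 0 < r₀ ∧ ∀ (x : Ω) (r : ℝ), 0 < r → r ≤ r₀ →
    ∃ n₀ : ℕ, ∀ n, n₀ ≤ n →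
      κ * m.real (ball x r) ≤ m.real (ball x r ∩ ubiquityUnion R β ρ l u n)) ∧
  IntersectionConditions m R β ρ u γ

/-- The exponent `σ = limsup log ρ(u_n) / log ψ(u_n)`. It is used only when `ψ(u_n)/ρ(u_n) → 0`;
then `ψ(u_n) < ρ(u_n) < 1` for large `n`, the quotient is eventually in `(0, 1)`, and the
real-valued limsup is the genuine one. -/
noncomputable def logExponent (ρ ψ : ℝ → ℝ) (u : ℕ → ℝ) : ℝ :=
  limsup (fun n => Real.log (ρ (u n)) / Real.log (ψ (u n))) atTop

end Ubiquity

/-! Part (i) is a mass transference argument that replaces a Cantor set and its limit measure by a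
sequence of measures of bounded density. Let `E n` be the union of the `ψ (β α)`-neighbourhoods over
the `n`-th block; since `l n → ∞`, a point lying in infinitely many `E n` lies in `Λ(ψ)`. For fixed
`ε`, measures of mass above `1/2` are built on nested open sets `V k`, with `closure (V (k + 1))`
inside `V k` and inside a union of sets `E n` with `n ≥ k`, all satisfying `μ (ball y r) ≤ ε (2 r) ^
s` below one common scale. A fine cover of the limsup set, slightly enlarged to be open, contains
some `closure (V k)` by compactness, so its `s`-sum plus an error at most `1` is at least a constant
over `ε`. Letting `ε → 0` gives `ℋ^s = ∞` (`RegularMeasure.hausdorffMeasure_limsup_eq_top`).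

The arbitrary `ε` comes from averaging. Moving the mass of `μ` into pieces of one `E n` of size `p`
gives growth `K₀ D r ^ δ` above scale `p` and only `K₀ D r ^ s` below it. The first is negligible
against `r ^ s` for small `r` because `s < δ`; the second is beaten, at still smaller `r`, by the
bounded density of the new measure. So one relocation is bad only on a bounded range of scales, and
`k` relocations with disjoint bad ranges average to a constant of order `K₀ D / k` plus a small
error (`RegularMeasure.exists_sum_relocation`, `RegularMeasure.exists_refinement`).

Ubiquity supplies about `(t / p) ^ δ` separated resonant points in a ball of radius `t`, where `p =
ρ(u_n)`, and the intersection conditions control `m` on a neighbourhood of the resonant set near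
each. The exponent `s` is admissible when `ρ(u_n) ^ (δ - γ)` is at most a constant times `ψ(u_n) ^
(s - γ)` infinitely often; with `s = γ + τ (δ - γ)` this follows from `ρ(u_n) ≤ C ψ(u_n) ^ τ`,
whence the exponent `σ`.

In part (ii) the same separated pieces have total `m`-measure bounded below for infinitely many `n`,
so `m (Λ(ψ)) > 0`. Regularity of `m` then gives positive `ℋ^δ`, and `ℋ^δ(Ω)` is finite. -/

open scoped ENNReal NNReal

namespace Ubiquity

/-! ### Separated sets and Ahlfors regular measures -/

section Basics

variable {Ω : Type*} [MetricSpace Ω]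

theorem exists_separated_finset [CompactSpace Ω] (T : Set Ω) {η : ℝ} (hη : 0 < η) :
    ∃ Z : Finset Ω, (Z : Set Ω) ⊆ T ∧ (∀ x ∈ Z, ∀ y ∈ Z, x ≠ y → η < dist x y) ∧
      ∀ y ∈ T, ∃ x ∈ Z, dist y x ≤ η := by
  obtain ⟨e, rfl⟩ : ∃ e : ℝ≥0, (e : ℝ) = η := ⟨⟨η, hη.le⟩, rfl⟩
  have he : e / 2 ≠ 0 := by
    have : e ≠ 0 := by rintro rfl; simp at hη
    positivity
  have hfin : packingNumber e T ≠ ⊤ := by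
    obtain ⟨N, -, hN, hc⟩ := exists_finite_isCover_of_totallyBounded (s := T) he
      (isCompact_univ.totallyBounded.subset (subset_univ T))
    have h1 := packingNumber_two_mul_le_externalCoveringNumber (e / 2) T
    have h2 := hc.externalCoveringNumber_le_encard
    rw [mul_div_cancel₀ _ (two_ne_zero)] at h1
    exact ne_top_of_le_ne_top (Set.encard_ne_top_iff.2 hN) (h1.trans h2)
  have hZ : (maximalSeparatedSet e T).Finite := by
    rw [← Set.encard_ne_top_iff, encard_maximalSeparatedSet hfin]
    exact hfin
  refine ⟨hZ.toFinset, by simpa using maximalSeparatedSet_subset, ?_, ?_⟩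
  · intro x hx y hy hxy
    have := isSeparated_maximalSeparatedSet (ε := e) (A := T) (by simpa using hx)
      (by simpa using hy) hxy
    have h' : (e : ℝ≥0∞) < edist x y := this
    rw [edist_nndist] at h'
    rw [dist_nndist]
    exact_mod_cast h'
  · intro y hy
    obtain ⟨x, hx, hxy⟩ := isCover_maximalSeparatedSet hfin hy
    refine ⟨x, by simpa using hx, ?_⟩
    have h' : edist y x ≤ e := hxy
    rw [edist_nndist] at h'
    rw [dist_nndist]
    exact_mod_cast h'

theorem exists_disjoint_refinement {ι X : Type*} [MeasurableSpace X] (S : Finset ι) (B : ι → Set X)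
    (hB : ∀ i ∈ S, MeasurableSet (B i)) :
    ∃ P : ι → Set X, (∀ i ∈ S, MeasurableSet (P i)) ∧ (∀ i ∈ S, P i ⊆ B i) ∧
      (∀ i ∈ S, ∀ j ∈ S, i ≠ j → Disjoint (P i) (P j)) ∧ ⋃ i ∈ S, P i = ⋃ i ∈ S, B i := by
  classical
  induction S using Finset.induction_on with
  | empty => exact ⟨B, by simp, by simp, by simp, by simp⟩
  | insert i S hi ih =>
    obtain ⟨P, hPm, hPB, hPd, hPu⟩ := ih fun j hj => hB j (Finset.mem_insert_of_mem hj)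
    have hne : ∀ j ∈ S, j ≠ i := fun j hj h => hi (h ▸ hj)
    have hd : ∀ j ∈ S, Disjoint (B i \ ⋃ k ∈ S, B k) (P j) := fun j hj =>
      disjoint_left.2 fun x hx hxj => hx.2 (mem_biUnion (x := j) hj (hPB j hj hxj))
    refine ⟨Function.update P i (B i \ ⋃ j ∈ S, B j), ?_, ?_, ?_, ?_⟩
    · intro j hj
      rcases Finset.mem_insert.1 hj with rfl | hj
      · simpa using (hB j (Finset.mem_insert_self _ _)).diff
          (S.measurableSet_biUnion fun k hk => hB k (Finset.mem_insert_of_mem hk))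
      · simpa [hne j hj] using hPm j hj
    · intro j hj
      rcases Finset.mem_insert.1 hj with rfl | hj
      · simp
      · simpa [hne j hj] using hPB j hj
    · intro j hj k hk hjk
      rcases Finset.mem_insert.1 hj with rfl | hj' <;> rcases Finset.mem_insert.1 hk with rfl | hk'
      · exact absurd rfl hjk
      · simpa [hne k hk'] using hd k hk'
      · simpa [hne j hj'] using (hd j hj').symm
      · simpa [hne j hj', hne k hk'] using hPd j hj' k hk' hjk
    · rw [Finset.set_biUnion_insert, Finset.set_biUnion_insert, Function.update_self]
      have : ⋃ j ∈ S, Function.update P i (B i \ ⋃ j ∈ S, B j) j = ⋃ j ∈ S, B j := by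
        rw [← hPu]
        exact iUnion₂_congr fun j hj => by rw [Function.update_of_ne (hne j hj)]
      rw [this, sdiff_union_self]

variable [MeasurableSpace Ω]

/-- `m` is Ahlfors regular of exponent `δ`, with the lower bound for radii up to `1` and the upper
bound for all radii. -/
structure RegularMeasure (m : Measure Ω) (δ a b : ℝ) : Prop where
  exp_pos : 0 < δ
  lower_pos : 0 < a
  upper_pos : 0 < b
  lower : ∀ x r, 0 < r → r ≤ 1 → a * r ^ δ ≤ m.real (ball x r)
  upper : ∀ x r, 0 < r → m.real (ball x r) ≤ b * r ^ δ

theorem ConditionM2.exists_regularMeasure {m : Measure Ω} [IsProbabilityMeasure m] {δ : ℝ}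
    (h : ConditionM2 m δ) : ∃ a b, RegularMeasure m δ a b := by
  obtain ⟨hδ, a, b, r₀, ha, hb, hr₀, H⟩ := h
  have hr1 : 0 < min r₀ 1 := lt_min hr₀ one_pos
  refine ⟨a * (min r₀ 1) ^ δ, max b (r₀ ^ δ)⁻¹, hδ, by positivity, by positivity, ?_, ?_⟩
  · intro x r hr hr1'
    rcases le_total r r₀ with h | h
    · refine le_trans ?_ (H x r hr h).1
      have : (min r₀ 1) ^ δ ≤ 1 := Real.rpow_le_one hr1.le (min_le_right _ _) hδ.le
      have h2 : 0 ≤ r ^ δ := by positivity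
      calc a * min r₀ 1 ^ δ * r ^ δ ≤ a * 1 * r ^ δ := by gcongr
        _ = _ := by ring
    · have h1 := (H x r₀ hr₀ le_rfl).1
      have h2 : m.real (ball x r₀) ≤ m.real (ball x r) :=
        measureReal_mono (ball_subset_ball h)
      have h3 : (min r₀ 1) ^ δ ≤ r₀ ^ δ := Real.rpow_le_rpow hr1.le (min_le_left _ _) hδ.le
      have h4 : r ^ δ ≤ 1 := Real.rpow_le_one hr.le hr1' hδ.le
      calc a * min r₀ 1 ^ δ * r ^ δ ≤ a * r₀ ^ δ * 1 := by gcongr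
        _ ≤ _ := by linarith
  · intro x r hr
    rcases le_total r r₀ with h | h
    · refine (H x r hr h).2.trans ?_
      gcongr
      exact le_max_left _ _
    · calc m.real (ball x r) ≤ 1 := measureReal_le_one
        _ = (r₀ ^ δ)⁻¹ * r₀ ^ δ := by field_simp
        _ ≤ max b (r₀ ^ δ)⁻¹ * r ^ δ := by
          gcongr
          exact le_max_right _ _

variable [BorelSpace Ω] {m : Measure Ω} [IsProbabilityMeasure m] {δ a b : ℝ}

/-- Volume packing: the balls of radius `η / 2` are disjoint and lie in `ball x (r + η)`. The bound
`η ≤ 2` keeps their radii in the range of the lower regularity estimate. -/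
theorem RegularMeasure.card_mul_le (hm : RegularMeasure m δ a b) {ι : Type*} (S : Finset ι)
    (z : ι → Ω) {η r : ℝ} {x : Ω} (hη : 0 < η) (hη2 : η ≤ 2) (hr : 0 < r)
    (hsep : ∀ i ∈ S, ∀ j ∈ S, i ≠ j → η ≤ dist (z i) (z j)) (hz : ∀ i ∈ S, z i ∈ ball x r) :
    S.card * (a * (η / 2) ^ δ) ≤ b * (r + η) ^ δ := by
  have hdisj : (S : Set ι).PairwiseDisjoint fun i => ball (z i) (η / 2) := by
    intro i hi j hj hij
    refine ball_disjoint_ball ?_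
    linarith [hsep i hi j hj hij]
  calc S.card * (a * (η / 2) ^ δ) = ∑ i ∈ S, a * (η / 2) ^ δ := by simp
    _ ≤ ∑ i ∈ S, m.real (ball (z i) (η / 2)) :=
      Finset.sum_le_sum fun i _ => hm.lower _ _ (by positivity) (by linarith)
    _ = m.real (⋃ i ∈ S, ball (z i) (η / 2)) :=
      (measureReal_biUnion_finset hdisj fun i _ => measurableSet_ball).symm
    _ ≤ m.real (ball x (r + η)) := by
      refine measureReal_mono (iUnion₂_subset fun i hi => ball_subset_ball' ?_)
      have := mem_ball.1 (hz i hi)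
      linarith
    _ ≤ _ := hm.upper _ _ (by positivity)

/-- A maximal `η`-separated set has at most `1 / (a (η / 2) ^ δ)` points, and its closed `η`-balls
cover with diameters at most `2 η`; the sums therefore stay below `4 ^ δ / a` at every scale. -/
theorem RegularMeasure.hausdorffMeasure_univ_lt_top [CompactSpace Ω]
    (hm : RegularMeasure m δ a b) :
    Measure.hausdorffMeasure δ (univ : Set Ω) < ⊤ := by
  have hδ := hm.exp_pos
  have ha := hm.lower_pos
  set η : ℕ → ℝ := fun n => 1 / ((n : ℝ) + 1) with hηdef
  have hη : ∀ n, 0 < η n := fun n => by positivity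
  have hη1 : ∀ n, η n ≤ 1 := fun n => by
    rw [hηdef]
    exact (div_le_one (by positivity)).2 (by linarith [n.cast_nonneg (α := ℝ)])
  choose Z hZ using fun n => exists_separated_finset (univ : Set Ω) (hη n)
  have hsum : ∀ n, ∑ i : (Z n), (ediam (closedBall (i : Ω) (η n))) ^ δ ≤
      ENNReal.ofReal (4 ^ δ / a) := by
    intro n
    have hdiam : ∀ i : (Z n), (ediam (closedBall (i : Ω) (η n))) ^ δ ≤
        ENNReal.ofReal ((2 * η n) ^ δ) := by
      intro i
      rw [← ENNReal.ofReal_rpow_of_pos (by have := hη n; positivity)]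
      refine ENNReal.rpow_le_rpow ?_ hδ.le
      refine ediam_le_of_forall_dist_le fun x hx y hy => ?_
      have h1 := mem_closedBall.1 hx
      have h2 := mem_closedBall'.1 hy
      linarith [dist_triangle x i y]
    refine (Finset.sum_le_sum fun i _ => hdiam i).trans ?_
    rw [Finset.sum_const, nsmul_eq_mul, ← ENNReal.ofReal_natCast,
      ← ENNReal.ofReal_mul (by positivity)]
    refine ENNReal.ofReal_le_ofReal ?_
    have hcard : (Z n).card * (a * (η n / 2) ^ δ) ≤ 1 := by
      have hdisj : ((Z n : Finset Ω) : Set Ω).PairwiseDisjoint fun i => ball i (η n / 2) := by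
        intro i hi j hj hij
        refine ball_disjoint_ball ?_
        linarith [(hZ n).2.1 i hi j hj hij]
      calc (Z n).card * (a * (η n / 2) ^ δ) = ∑ i ∈ Z n, a * (η n / 2) ^ δ := by simp
        _ ≤ ∑ i ∈ Z n, m.real (ball i (η n / 2)) :=
          Finset.sum_le_sum fun i _ => hm.lower _ _ (by have := hη n; positivity)
            (by linarith [hη n, hη1 n])
        _ = m.real (⋃ i ∈ Z n, ball i (η n / 2)) :=
          (measureReal_biUnion_finset hdisj fun i _ => measurableSet_ball).symm
        _ ≤ 1 := measureReal_le_one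
    have : (2 * η n) ^ δ = 4 ^ δ * (η n / 2) ^ δ := by
      rw [← Real.mul_rpow (by norm_num) (by have := hη n; positivity)]
      ring_nf
    rw [Finset.card_univ, Fintype.card_coe, this, le_div_iff₀ ha]
    have h4 : (0 : ℝ) < 4 ^ δ := by positivity
    nlinarith
  have hr : Tendsto (fun n => ENNReal.ofReal (2 * η n)) atTop (𝓝 0) := by
    rw [← ENNReal.ofReal_zero]
    refine ENNReal.tendsto_ofReal ?_
    simpa [hηdef] using (tendsto_one_div_add_atTop_nhds_zero_nat (𝕜 := ℝ)).const_mul 2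
  have := Measure.hausdorffMeasure_le_liminf_sum δ (univ : Set Ω)
    (fun n => ENNReal.ofReal (2 * η n)) hr
    (fun n (i : (Z n)) => closedBall (i : Ω) (η n))
    (Eventually.of_forall fun n i => ediam_le_of_forall_dist_le fun x hx y hy => by
      have h1 := mem_closedBall.1 hx
      have h2 := mem_closedBall'.1 hy
      linarith [dist_triangle x i y])
    (Eventually.of_forall fun n x _ => by
      obtain ⟨z, hz, hxz⟩ := (hZ n).2.2 x (mem_univ x)
      exact mem_iUnion.2 ⟨⟨z, hz⟩, hxz⟩)
  refine this.trans_lt (lt_of_le_of_lt ?_ (ENNReal.ofReal_lt_top (r := 4 ^ δ / a)))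
  exact liminf_le_of_le (by isBoundedDefault) fun c hc => by
    obtain ⟨n, hn⟩ := hc.exists
    exact hn.trans (hsum n)

theorem RegularMeasure.dimH_univ_le [CompactSpace Ω] (hm : RegularMeasure m δ a b) :
    dimH (univ : Set Ω) ≤ ENNReal.ofReal δ := by
  have h := hm.hausdorffMeasure_univ_lt_top.ne
  have hδ := hm.exp_pos
  lift δ to ℝ≥0 using hδ.le
  rw [ENNReal.ofReal_coe_nnreal]
  exact dimH_le_of_hausdorffMeasure_ne_top h

theorem exists_rpow_le_rpow {s t : ℝ} (hst : s < t) (K : ℝ) {e : ℝ} (he : 0 < e) :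
    ∃ r' > 0, ∀ r, 0 < r → r < r' → K * r ^ t ≤ e * r ^ s := by
  have h : Tendsto (fun r : ℝ => K * r ^ (t - s)) (𝓝[>] 0) (𝓝 0) := by
    have : Tendsto (fun r : ℝ => r ^ (t - s)) (𝓝 0) (𝓝 0) := by
      have := (Real.continuousAt_rpow_const 0 (t - s) (Or.inr (by linarith))).tendsto
      rwa [Real.zero_rpow (by linarith)] at this
    simpa using (this.mono_left nhdsWithin_le_nhds).const_mul K
  have h2 := h.eventually (gt_mem_nhds he)
  obtain ⟨r', hr', H⟩ := mem_nhdsGT_iff_exists_Ioo_subset.1 h2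
  refine ⟨r', hr', fun r hr hrr => ?_⟩
  have h3 : K * r ^ (t - s) < e := H ⟨hr, hrr⟩
  have h4 : r ^ t = r ^ (t - s) * r ^ s := by rw [← Real.rpow_add hr]; ring_nf
  rw [h4, ← mul_assoc]
  gcongr

end Basics

/-! ### Relocating mass onto small separated pieces -/

section Spread

variable {Ω ι : Type*} [MeasurableSpace Ω] {m : Measure Ω}

/-- The measure which spreads the mass `v i` uniformly, with respect to `m`, over `F i`. -/
noncomputable def spreadMeasure (m : Measure Ω) (S : Finset ι) (F : ι → Set Ω) (v : ι → ℝ) :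
    Measure Ω :=
  ∑ i ∈ S, ENNReal.ofReal (v i / m.real (F i)) • m.restrict (F i)

theorem spreadMeasure_le {S : Finset ι} {F : ι → Set Ω} {v : ι → ℝ} (hv : ∀ i ∈ S, 0 ≤ v i) :
    spreadMeasure m S F v ≤ ENNReal.ofReal (∑ i ∈ S, v i / m.real (F i)) • m := by
  rw [spreadMeasure, ENNReal.ofReal_sum_of_nonneg
    fun i hi => div_nonneg (hv i hi) measureReal_nonneg, Finset.sum_smul]
  refine Finset.sum_le_sum fun i _ => ?_
  gcongr
  exact Measure.restrict_le_self

theorem real_le_of_le_smul [IsFiniteMeasure m] {μ : Measure Ω} {D : ℝ} (hD : 0 ≤ D)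
    (h : μ ≤ ENNReal.ofReal D • m) (A : Set Ω) : μ.real A ≤ D * m.real A := by
  have h1 : μ A ≤ ENNReal.ofReal D * m A := h A
  have := ENNReal.toReal_mono (ENNReal.mul_ne_top ENNReal.ofReal_ne_top (measure_ne_top _ _)) h1
  rwa [ENNReal.toReal_mul, ENNReal.toReal_ofReal hD] at this

theorem isFiniteMeasure_of_le_smul [IsFiniteMeasure m] {μ : Measure Ω} {D : ℝ}
    (h : μ ≤ ENNReal.ofReal D • m) : IsFiniteMeasure μ :=
  ⟨(h univ).trans_lt (ENNReal.mul_lt_top ENNReal.ofReal_lt_top (measure_lt_top m univ))⟩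

variable [MetricSpace Ω] [BorelSpace Ω] {S : Finset ι} {F : ι → Set Ω} {v : ι → ℝ}

theorem spreadMeasure_compl (hF : ∀ i ∈ S, IsOpen (F i)) :
    spreadMeasure m S F v (⋃ i ∈ S, F i)ᶜ = 0 := by
  rw [spreadMeasure, Measure.finsetSum_apply]
  refine Finset.sum_eq_zero fun i hi => ?_
  rw [Measure.smul_apply, Measure.restrict_apply' (hF i hi).measurableSet]
  have : (⋃ i ∈ S, F i)ᶜ ∩ F i = ∅ := by
    refine eq_empty_of_forall_notMem fun x hx => hx.1 (mem_biUnion (x := i) hi hx.2)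
  rw [this, measure_empty, smul_zero]

variable [IsProbabilityMeasure m] {δ a b : ℝ}

theorem spreadMeasure_real_apply (hF : ∀ i ∈ S, IsOpen (F i)) (hv : ∀ i ∈ S, 0 ≤ v i) (A : Set Ω) :
    (spreadMeasure m S F v).real A = ∑ i ∈ S, v i / m.real (F i) * m.real (A ∩ F i) := by
  rw [spreadMeasure, measureReal_def, Measure.finsetSum_apply, ENNReal.toReal_sum]
  · refine Finset.sum_congr rfl fun i hi => ?_
    rw [Measure.smul_apply, Measure.restrict_apply' (hF i hi).measurableSet, smul_eq_mul,
      ENNReal.toReal_mul, ENNReal.toReal_ofReal (div_nonneg (hv i hi) measureReal_nonneg),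
      measureReal_def, measureReal_def]
  · intro i _
    exact ENNReal.mul_ne_top ENNReal.ofReal_ne_top (measure_ne_top _ _)

theorem spreadMeasure_real_univ (hF : ∀ i ∈ S, IsOpen (F i)) (hv : ∀ i ∈ S, 0 ≤ v i)
    (hFm : ∀ i ∈ S, 0 < m.real (F i)) :
    (spreadMeasure m S F v).real univ = ∑ i ∈ S, v i := by
  rw [spreadMeasure_real_apply hF hv]
  refine Finset.sum_congr rfl fun i hi => ?_
  rw [univ_inter, div_mul_cancel₀ _ (hFm i hi).ne']

theorem spreadMeasure_real_le_sum (hF : ∀ i ∈ S, IsOpen (F i)) (hv : ∀ i ∈ S, 0 ≤ v i)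
    (hFm : ∀ i ∈ S, 0 < m.real (F i)) (A : Set Ω) [DecidablePred fun i => (A ∩ F i).Nonempty] :
    (spreadMeasure m S F v).real A ≤ ∑ i ∈ S with (A ∩ F i).Nonempty, v i := by
  rw [spreadMeasure_real_apply hF hv, Finset.sum_filter]
  refine Finset.sum_le_sum fun i hi => ?_
  split_ifs with h
  · calc v i / m.real (F i) * m.real (A ∩ F i) ≤ v i / m.real (F i) * m.real (F i) := by
          have := hv i hi
          have := hFm i hi
          gcongr
          · exact measure_ne_top _ _
          · exact inter_subset_right
      _ = v i := div_mul_cancel₀ _ (hFm i hi).ne'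
  · rw [not_nonempty_iff_eq_empty.1 h]
    simp

/-- Above the scale of the pieces only their number matters: packing bounds how many meet the ball,
each of mass at most `L p ^ δ`. -/
theorem spreadMeasure_ball_le_of_le (hm : RegularMeasure m δ a b)
    (hF : ∀ i ∈ S, IsOpen (F i)) (hv : ∀ i ∈ S, 0 ≤ v i) (hFm : ∀ i ∈ S, 0 < m.real (F i))
    {z : ι → Ω} {p L : ℝ} (hp : 0 < p) (hp2 : p ≤ 2) (hL : 0 ≤ L)
    (hvL : ∀ i ∈ S, v i ≤ L * p ^ δ)
    (hsep : ∀ i ∈ S, ∀ j ∈ S, i ≠ j → 3 * p ≤ dist (z i) (z j))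
    (hFz : ∀ i ∈ S, F i ⊆ ball (z i) (p / 2)) {y : Ω} {r : ℝ} (hr : p / 2 ≤ r) :
    (spreadMeasure m S F v).real (ball y r) ≤ L * (b / a * 8 ^ δ) * r ^ δ := by
  classical
  have ha := hm.lower_pos
  have hb := hm.upper_pos
  have hr0 : 0 < r := by linarith
  refine (spreadMeasure_real_le_sum hF hv hFm _).trans ?_
  set T := {i ∈ S | (ball y r ∩ F i).Nonempty} with hT
  have hTS : ∀ i ∈ T, i ∈ S := fun i hi => (Finset.mem_filter.1 hi).1
  have hcard := hm.card_mul_le T z (η := p) (r := r + p / 2) (x := y) hp hp2 (by linarith)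
    (fun i hi j hj hij => by linarith [hsep i (hTS i hi) j (hTS j hj) hij]) (fun i hi => by
      obtain ⟨w, hw1, hw2⟩ := (Finset.mem_filter.1 hi).2
      have h1 := mem_ball'.1 (hFz i (hTS i hi) hw2)
      have h2 := mem_ball.1 hw1
      rw [mem_ball]
      linarith [dist_triangle (z i) w y])
  have h3 : b * (r + p / 2 + p) ^ δ ≤ b * (4 * r) ^ δ := by
    have := hm.exp_pos
    gcongr
    linarith
  have h4 : (8 : ℝ) ^ δ * r ^ δ = 2 ^ δ * (4 * r) ^ δ := by
    rw [← Real.mul_rpow (by norm_num) hr0.le, ← Real.mul_rpow (by norm_num) (by positivity)]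
    ring_nf
  have h5 : p ^ δ = 2 ^ δ * (p / 2) ^ δ := by
    rw [← Real.mul_rpow (by norm_num) (by positivity)]
    ring_nf
  have h2δ : (0 : ℝ) < 2 ^ δ := by positivity
  calc ∑ i ∈ T, v i ≤ ∑ i ∈ T, L * p ^ δ := Finset.sum_le_sum fun i hi => hvL i (hTS i hi)
    _ = L * 2 ^ δ / a * (T.card * (a * (p / 2) ^ δ)) := by
      rw [Finset.sum_const, nsmul_eq_mul, h5]
      field_simp
    _ ≤ L * 2 ^ δ / a * (b * (4 * r) ^ δ) := by
      exact mul_le_mul_of_nonneg_left (hcard.trans h3) (by positivity)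
    _ = L * (b / a) * (8 ^ δ * r ^ δ) := by rw [h4]; field_simp
    _ = _ := by ring

/-- Below the scale of the pieces the ball meets at most one of them, because distinct pieces are at
least `2 p` apart; the growth inside that piece decides. -/
theorem spreadMeasure_ball_le_of_ge
    (hF : ∀ i ∈ S, IsOpen (F i)) (hv : ∀ i ∈ S, 0 ≤ v i) (hFm : ∀ i ∈ S, 0 < m.real (F i))
    {z : ι → Ω} {p L C s : ℝ} (hL : 0 ≤ L) (hC : 0 ≤ C)
    (hvL : ∀ i ∈ S, v i ≤ L * p ^ δ)
    (hsep : ∀ i ∈ S, ∀ j ∈ S, i ≠ j → 3 * p ≤ dist (z i) (z j))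
    (hFz : ∀ i ∈ S, F i ⊆ ball (z i) (p / 2))
    (hFC : ∀ i ∈ S, ∀ y r, 0 < r → r ≤ p →
      m.real (ball y r ∩ F i) * p ^ δ ≤ C * r ^ s * m.real (F i))
    {y : Ω} {r : ℝ} (hr0 : 0 < r) (hr : r ≤ p / 2) :
    (spreadMeasure m S F v).real (ball y r) ≤ L * C * r ^ s := by
  rw [spreadMeasure_real_apply hF hv]
  have hone : ∀ i ∈ S, ∀ j ∈ S, i ≠ j → (ball y r ∩ F i).Nonempty → ball y r ∩ F j = ∅ := by
    intro i hi j hj hij ⟨w, hw1, hw2⟩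
    refine eq_empty_of_forall_notMem fun w' hw' => ?_
    have h1 := mem_ball'.1 (hFz i hi hw2)
    have h2 := mem_ball.1 hw1
    have h3 := mem_ball.1 (hFz j hj hw'.2)
    have h4 := mem_ball'.1 hw'.1
    have := dist_triangle4 (z i) w y w'
    linarith [hsep i hi j hj hij, dist_triangle (z i) w' (z j)]
  by_cases hex : ∃ i ∈ S, (ball y r ∩ F i).Nonempty
  · obtain ⟨i, hi, hne⟩ := hex
    rw [Finset.sum_eq_single_of_mem i hi fun j hj hji => by
      rw [hone i hi j hj hji.symm hne]; simp]
    have hFi := hFm i hi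
    calc v i / m.real (F i) * m.real (ball y r ∩ F i)
        ≤ L * p ^ δ / m.real (F i) * m.real (ball y r ∩ F i) := by
          have := hvL i hi
          gcongr
      _ = L / m.real (F i) * (m.real (ball y r ∩ F i) * p ^ δ) := by ring
      _ ≤ L / m.real (F i) * (C * r ^ s * m.real (F i)) := by
          have := hFC i hi y r hr0 (by linarith)
          gcongr
      _ = L * C * r ^ s := by field_simp
  · push Not at hex
    rw [Finset.sum_eq_zero fun i hi => by rw [hex i hi]; simp]
    positivity

/-- At arbitrarily fine scales, every member of a finite family of equal balls contains many well
separated open pieces of `E n`, each of which carries a normalised restriction of `m` satisfying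
a growth condition of exponent `s`. -/
def HasSpreading (m : Measure Ω) (E : ℕ → Set Ω) (δ s κ C t₀ : ℝ) : Prop :=
  ∀ (X : Finset Ω) (t : ℝ), 0 < t → t ≤ t₀ → ∀ (N : ℕ) (η : ℝ), 0 < η →
    ∃ n, N ≤ n ∧ ∃ p, 0 < p ∧ p < η ∧ ∃ F : Ω → Set Ω, ∀ x ∈ X, ∃ Z : Finset Ω,
      (∀ c ∈ Z, c ∈ ball x (t + p)) ∧ (∀ c ∈ Z, ∀ c' ∈ Z, c ≠ c' → 3 * p ≤ dist c c') ∧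
      κ * t ^ δ ≤ Z.card * p ^ δ ∧
      ∀ c ∈ Z, IsOpen (F c) ∧ F c ⊆ ball c (p / 2) ∧ closure (F c) ⊆ E n ∧ 0 < m.real (F c) ∧
        ∀ y r, 0 < r → r ≤ p → m.real (ball y r ∩ F c) * p ^ δ ≤ C * r ^ s * m.real (F c)

/-- Relocation of a bounded-density measure `μ` to `E n` at mesh `τ`. -/
theorem RegularMeasure.exists_relocation [CompactSpace Ω] (hm : RegularMeasure m δ a b)
    {E : ℕ → Set Ω} {s κ C t₀ : ℝ} (hκ : 0 < κ) (hC : 0 < C)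
    (hE : HasSpreading m E δ s κ C t₀) :
    ∃ K₀ > 0, ∀ (μ : Measure Ω) (U : Set Ω) (D τ : ℝ), 0 < D →
      μ ≤ ENNReal.ofReal D • m → 0 < τ → τ ≤ 1 → τ / 4 ≤ t₀ → ∀ (N : ℕ) (η : ℝ), 0 < η →
      ∃ n, N ≤ n ∧ ∃ p, 0 < p ∧ p < η ∧ ∃ (ν : Measure Ω) (V : Set Ω) (D' : ℝ),
        IsOpen V ∧ closure V ⊆ U ∩ E n ∧ ν Vᶜ = 0 ∧ 0 < D' ∧ ν ≤ ENNReal.ofReal D' • m ∧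
        μ.real {x | closedBall x (3 * τ) ⊆ U} ≤ ν.real univ ∧
        (∀ y r, 0 < r → ν.real (ball y r) ≤ μ.real (ball y (r + 2 * τ))) ∧
        (∀ y r, p / 2 ≤ r → ν.real (ball y r) ≤ K₀ * D * r ^ δ) ∧
        (∀ y r, 0 < r → r ≤ p / 2 → ν.real (ball y r) ≤ K₀ * D * r ^ s) := by
  classical
  have ha := hm.lower_pos
  have hb := hm.upper_pos
  have hδ := hm.exp_pos
  refine ⟨b * 8 ^ δ / κ * max (b / a * 8 ^ δ) C, by positivity, ?_⟩
  intro μ U D τ hD hμ hτ hτ1 hτt N η hη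
  have := isFiniteMeasure_of_le_smul hμ
  obtain ⟨X, hXU, hXsep, hXcov⟩ :=
    exists_separated_finset {x | closedBall x (3 * τ) ⊆ U} hτ
  obtain ⟨P, hPm, hPB, hPd, hPu⟩ :=
    exists_disjoint_refinement X (fun x => closedBall x τ) fun x _ => measurableSet_closedBall
  -- The points of `X` are more than `τ` apart, so with radius `τ / 4` and `p < τ / 20` pieces
  -- belonging to different points stay separated by the required `3 p`, and each piece stays close
  -- to its cell.
  obtain ⟨n, hn, p, hp, hpη, F, hF⟩ := hE X (τ / 4) (by positivity) hτt N (min η (τ / 20))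
    (by positivity)
  have hpτ : p < τ / 20 := hpη.trans_le (min_le_right _ _)
  choose! Z hZball hZsep hZcard hZF using hF
  have hZpos : ∀ x ∈ X, (0 : ℝ) < (Z x).card := by
    intro x hx
    have h1 := hZcard x hx
    have h2 : 0 < κ * (τ / 4) ^ δ := by positivity
    have h3 : 0 < p ^ δ := by positivity
    exact pos_of_mul_pos_left (h2.trans_le h1) h3.le
  set S : Finset (Σ _ : Ω, Ω) := X.sigma Z with hS
  have hSmem : ∀ i ∈ S, i.1 ∈ X ∧ i.2 ∈ Z i.1 := fun i hi => Finset.mem_sigma.1 hi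
  set v : (Σ _ : Ω, Ω) → ℝ := fun i => μ.real (P i.1) / (Z i.1).card with hvdef
  set G : (Σ _ : Ω, Ω) → Set Ω := fun i => F i.2 with hG
  have hGo : ∀ i ∈ S, IsOpen (G i) := fun i hi => (hZF _ (hSmem i hi).1 _ (hSmem i hi).2).1
  have hGz : ∀ i ∈ S, G i ⊆ ball i.2 (p / 2) := fun i hi =>
    (hZF _ (hSmem i hi).1 _ (hSmem i hi).2).2.1
  have hGm : ∀ i ∈ S, 0 < m.real (G i) := fun i hi =>
    (hZF _ (hSmem i hi).1 _ (hSmem i hi).2).2.2.2.1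
  have hGx : ∀ i ∈ S, G i ⊆ ball i.1 (τ / 4 + 2 * p) := fun i hi => by
    refine (hGz i hi).trans (ball_subset_ball' ?_)
    have := mem_ball.1 (hZball _ (hSmem i hi).1 _ (hSmem i hi).2)
    linarith
  have hv : ∀ i ∈ S, 0 ≤ v i := fun i _ => by positivity
  -- A cell carries at most `D b (2 τ) ^ δ`, shared among at least `κ (τ / 4) ^ δ / p ^ δ` pieces.
  -- The mesh cancels up to the ratio `8 ^ δ`, so `K₀` depends on neither `τ` nor `p`.
  have hvL : ∀ i ∈ S, v i ≤ D * (b * 8 ^ δ / κ) * p ^ δ := by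
    intro i hi
    have h1 := hZcard _ (hSmem i hi).1
    have h2 := hZpos _ (hSmem i hi).1
    have h3 : μ.real (P i.1) ≤ D * (b * (2 * τ) ^ δ) := by
      refine (real_le_of_le_smul hD.le hμ _).trans ?_
      gcongr
      refine (measureReal_mono ?_).trans (hm.upper i.1 (2 * τ) (by positivity))
      exact (hPB _ (hSmem i hi).1).trans (closedBall_subset_ball (by linarith))
    have h4 : (2 * τ) ^ δ = 8 ^ δ * (τ / 4) ^ δ := by
      rw [← Real.mul_rpow (by norm_num) (by positivity)]
      ring_nf
    rw [hvdef]
    simp only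
    rw [div_le_iff₀ h2]
    calc μ.real (P i.1) ≤ D * (b * (2 * τ) ^ δ) := h3
      _ = D * (b * 8 ^ δ / κ) * (κ * (τ / 4) ^ δ) := by rw [h4]; field_simp
      _ ≤ D * (b * 8 ^ δ / κ) * ((Z i.1).card * p ^ δ) := by gcongr
      _ = _ := by ring
  have hsep : ∀ i ∈ S, ∀ j ∈ S, i ≠ j → 3 * p ≤ dist i.2 j.2 := by
    rintro ⟨x, c⟩ hi ⟨x', c'⟩ hj hij
    have hi' := hSmem _ hi
    have hj' := hSmem _ hj
    simp only at hi' hj' ⊢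
    by_cases hx : x = x'
    · subst hx
      exact hZsep x hi'.1 c hi'.2 c' hj'.2 (by rintro rfl; exact hij rfl)
    · have h1 := hXsep x hi'.1 x' hj'.1 hx
      have h2 := mem_ball'.1 (hZball _ hi'.1 _ hi'.2)
      have h3 := mem_ball.1 (hZball _ hj'.1 _ hj'.2)
      have := dist_triangle4 x c c' x'
      linarith
  have hsum : ∀ Y ⊆ X, ∑ x ∈ Y, ∑ c ∈ Z x, v ⟨x, c⟩ = μ.real (⋃ x ∈ Y, P x) := by
    intro Y hY
    rw [measureReal_biUnion_finset (fun x hx y hy hxy => hPd x (hY hx) y (hY hy) hxy)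
      fun x hx => hPm x (hY hx)]
    refine Finset.sum_congr rfl fun x hx => ?_
    simp only [hvdef, Finset.sum_const, nsmul_eq_mul]
    exact mul_div_cancel₀ _ (hZpos x (hY hx)).ne'
  have hL : 0 ≤ D * (b * 8 ^ δ / κ) := by positivity
  -- The summand `1` keeps the density bound positive even when there are no pieces.
  refine ⟨n, hn, p, hp, hpη.trans_le (min_le_left _ _), spreadMeasure m S G v, ⋃ i ∈ S, G i,
    ∑ i ∈ S, v i / m.real (G i) + 1, isOpen_biUnion hGo, ?_, spreadMeasure_compl hGo, ?_, ?_, ?_,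
    ?_, ?_, ?_⟩
  · rw [Finset.closure_biUnion]
    refine iUnion₂_subset fun i hi => subset_inter ?_ ?_
    · refine ((closure_mono (hGx i hi)).trans closure_ball_subset_closedBall).trans ?_
      exact (closedBall_subset_closedBall (by linarith)).trans (hXU (hSmem i hi).1)
    · exact (hZF _ (hSmem i hi).1 _ (hSmem i hi).2).2.2.1
  · have : 0 ≤ ∑ i ∈ S, v i / m.real (G i) :=
      Finset.sum_nonneg fun i hi => div_nonneg (hv i hi) measureReal_nonneg
    linarith
  · refine (spreadMeasure_le hv).trans ?_
    gcongr
    linarith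
  · rw [spreadMeasure_real_univ hGo hv hGm, hS, Finset.sum_sigma, hsum X subset_rfl, hPu]
    refine measureReal_mono (fun y hy => ?_) (measure_ne_top _ _)
    obtain ⟨x, hx, hyx⟩ := hXcov y hy
    exact mem_biUnion (x := x) hx hyx
  · intro y r hr
    refine (spreadMeasure_real_le_sum hGo hv hGm _).trans ?_
    set Y := {x ∈ X | ∃ c ∈ Z x, (ball y r ∩ F c).Nonempty} with hY
    have hYX : Y ⊆ X := Finset.filter_subset _ _
    calc ∑ i ∈ S with (ball y r ∩ G i).Nonempty, v i ≤ ∑ i ∈ Y.sigma Z, v i := by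
          refine Finset.sum_le_sum_of_subset_of_nonneg ?_ fun i _ _ => by positivity
          intro i hi
          obtain ⟨hi, hne⟩ := Finset.mem_filter.1 hi
          exact Finset.mem_sigma.2 ⟨Finset.mem_filter.2 ⟨(hSmem i hi).1, i.2, (hSmem i hi).2, hne⟩,
            (hSmem i hi).2⟩
      _ = μ.real (⋃ x ∈ Y, P x) := by rw [Finset.sum_sigma, hsum Y hYX]
      _ ≤ μ.real (ball y (r + 2 * τ)) := by
          refine measureReal_mono (iUnion₂_subset fun x hx => ?_)
          obtain ⟨hx, c, hc, w, hw1, hw2⟩ := Finset.mem_filter.1 hx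
          refine (hPB x hx).trans (closedBall_subset_ball' ?_)
          have h1 := mem_ball.1 hw1
          have h2 := mem_ball'.1 (hGx ⟨x, c⟩ (Finset.mem_sigma.2 ⟨hx, hc⟩) hw2)
          simp only at h2
          linarith [dist_triangle x w y]
  · intro y r hr
    refine (spreadMeasure_ball_le_of_le hm hGo hv hGm (z := fun i => i.2) hp (by linarith) hL hvL
      hsep hGz hr).trans ?_
    have hr0 : 0 < r := by linarith
    have h1 := le_max_left (b / a * 8 ^ δ) C
    calc D * (b * 8 ^ δ / κ) * (b / a * 8 ^ δ) * r ^ δ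
        ≤ D * (b * 8 ^ δ / κ) * max (b / a * 8 ^ δ) C * r ^ δ := by gcongr
      _ = _ := by ring
  · intro y r hr0 hr
    refine (spreadMeasure_ball_le_of_ge hGo hv hGm (z := fun i => i.2) (C := C) (s := s) hL
      hC.le hvL hsep hGz
      (fun i hi => (hZF _ (hSmem i hi).1 _ (hSmem i hi).2).2.2.2.2) hr0 hr).trans ?_
    have h1 := le_max_right (b / a * 8 ^ δ) C
    calc D * (b * 8 ^ δ / κ) * C * r ^ s
        ≤ D * (b * 8 ^ δ / κ) * max (b / a * 8 ^ δ) C * r ^ s := by gcongr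
      _ = _ := by ring

end Spread

/-! ### Averaging relocations to gain an arbitrarily small constant -/

section Refine

variable {Ω : Type*} [MetricSpace Ω] [MeasurableSpace Ω] {m : Measure Ω} {δ a b : ℝ}

theorem exists_closedBall_subset_measure {μ : Measure Ω} [IsFiniteMeasure μ] {U : Set Ω}
    (hU : IsOpen U) (hμU : μ Uᶜ = 0) {loss ζ : ℝ} (hloss : 0 < loss) (hζ : 0 < ζ) :
    ∃ τ, 0 < τ ∧ τ < ζ ∧ μ.real univ - loss ≤ μ.real {x | closedBall x (3 * τ) ⊆ U} := by
  set η : ℕ → ℝ := fun n => 1 / ((n : ℝ) + 1) with hη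
  have hpos : ∀ n, 0 < η n := fun n => by positivity
  have hlim : Tendsto η atTop (𝓝 0) := tendsto_one_div_add_atTop_nhds_zero_nat
  have hanti : Antitone η := fun i j hij => one_div_le_one_div_of_le (by positivity) (by gcongr)
  set G : ℕ → Set Ω := fun n => {x | closedBall x (3 * η n) ⊆ U} with hG
  have hmono : Monotone G := fun i j hij x hx =>
    (closedBall_subset_closedBall (by linarith [hanti hij])).trans hx
  have hunion : ⋃ n, G n = U := by
    refine Subset.antisymm (iUnion_subset fun n x hx => hx (mem_closedBall_self ?_)) fun x hx => ?_
    · linarith [hpos n]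
    · obtain ⟨r, hr, hrU⟩ := nhds_basis_closedBall.mem_iff.1 (hU.mem_nhds hx)
      obtain ⟨n, hn⟩ := (hlim.eventually (gt_mem_nhds (show 0 < r / 3 by positivity))).exists
      exact mem_iUnion.2 ⟨n, (closedBall_subset_closedBall (by linarith)).trans hrU⟩
  have htend : Tendsto (fun n => μ.real (G n)) atTop (𝓝 (μ.real univ)) := by
    have h1 := tendsto_measure_iUnion_atTop (μ := μ) hmono
    have h2 : μ (⋃ n, G n) = μ univ := by
      rw [hunion]
      exact measure_of_measure_compl_eq_zero hμU
    rw [h2] at h1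
    exact (ENNReal.tendsto_toReal (measure_ne_top μ univ)).comp h1
  obtain ⟨n, hn1, hn2⟩ := ((htend.eventually (lt_mem_nhds (sub_lt_self _ hloss))).and
    (hlim.eventually (gt_mem_nhds hζ))).exists
  exact ⟨η n, hpos n, hn2, hn1.le⟩

variable [BorelSpace Ω] [IsProbabilityMeasure m]

/-- Each new relocation is made at a scale `p` below the threshold `t` under which all earlier ones
are already harmless. For `r ≤ p / 2` only the new summand can be bad; for `r ≥ p / 2` the new one
costs at most `e r ^ s`. Hence the large term `K₀ D` is paid only once, whatever `k` is. -/
theorem RegularMeasure.exists_sum_relocation [CompactSpace Ω] (hm : RegularMeasure m δ a b)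
    {E : ℕ → Set Ω} {s κ C t₀ : ℝ} (hs : s < δ) (hκ : 0 < κ) (hC : 0 < C)
    (hE : HasSpreading m E δ s κ C t₀) :
    ∃ K₀ > 0, ∀ (μ : Measure Ω) (U : Set Ω) (D τ : ℝ), 0 < D →
      μ ≤ ENNReal.ofReal D • m → 0 < τ → τ ≤ 1 → τ / 4 ≤ t₀ →
      ∀ (N : ℕ) (e r' : ℝ), 0 < e → (∀ r, 0 < r → r < r' → K₀ * D * r ^ δ ≤ e * r ^ s) →
      ∀ k : ℕ, ∃ (ν : Measure Ω) (V : Set Ω) (D' t : ℝ),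
        IsOpen V ∧ closure V ⊆ U ∩ ⋃ n ≥ N, E n ∧ ν Vᶜ = 0 ∧ 0 < D' ∧ ν ≤ ENNReal.ofReal D' • m ∧
        k * μ.real {x | closedBall x (3 * τ) ⊆ U} ≤ ν.real univ ∧
        (∀ y r, 0 < r → ν.real (ball y r) ≤ k * μ.real (ball y (r + 2 * τ))) ∧
        0 < t ∧ (∀ y r, 0 < r → r < r' → ν.real (ball y r) ≤ (k * e + K₀ * D) * r ^ s) ∧
        (∀ y r, 0 < r → r < t → ν.real (ball y r) ≤ k * e * r ^ s) := by
  obtain ⟨K₀, hK₀, H⟩ := hm.exists_relocation hκ hC hE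
  refine ⟨K₀, hK₀, fun μ U D τ hD hμ hτ hτ1 hτt N e r' he hr' k => ?_⟩
  induction k with
  | zero =>
    refine ⟨0, ∅, 1, 1, isOpen_empty, by simp, by simp, one_pos, Measure.zero_le _, by simp,
      by simp, one_pos, fun y r hr _ => ?_, by simp⟩
    simp only [measureReal_zero, CharP.cast_eq_zero, zero_mul, zero_add]
    positivity
  | succ k ih =>
    obtain ⟨ν, V, D', t, hV, hVU, hνV, hD', hνD, hmass, hmove, ht, hbig, hsmall⟩ := ih
    obtain ⟨n, hn, p, hp, hpt, ν₁, V₁, D₁, hV₁, hVU₁, hνV₁, hD₁, hνD₁, hmass₁, hmove₁, hbig₁,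
      hsmall₁⟩ := H μ U D τ hD hμ hτ hτ1 hτt N t ht
    -- Below `t₁` the bounded density of the new summand alone makes it at most `e r ^ s`; this
    -- restores the invariant for the next step.
    obtain ⟨t₁, ht₁, htb⟩ := exists_rpow_le_rpow hs (D₁ * b) he
    have := isFiniteMeasure_of_le_smul hνD
    have := isFiniteMeasure_of_le_smul hνD₁
    refine ⟨ν + ν₁, V ∪ V₁, D' + D₁, min t t₁, hV.union hV₁, ?_, ?_, by positivity, ?_, ?_, ?_,
      lt_min ht ht₁, ?_, ?_⟩
    · rw [closure_union]
      refine union_subset hVU (hVU₁.trans (inter_subset_inter_right _ ?_))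
      exact subset_iUnion₂_of_subset n hn subset_rfl
    · rw [Measure.add_apply, measure_mono_null (compl_subset_compl.2 subset_union_left) hνV,
        measure_mono_null (compl_subset_compl.2 subset_union_right) hνV₁, add_zero]
    · rw [ENNReal.ofReal_add hD'.le hD₁.le, add_smul]
      exact add_le_add hνD hνD₁
    · rw [measureReal_add_apply]
      push_cast
      linarith
    · intro y r hr
      rw [measureReal_add_apply]
      push_cast
      linarith [hmove y r hr, hmove₁ y r hr]
    · intro y r hr hrr
      rw [measureReal_add_apply]
      push_cast
      rcases le_total r (p / 2) with h | h
      · have h1 := hsmall y r hr (by linarith)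
        have h2 := hsmall₁ y r hr h
        have h3 : 0 ≤ e * r ^ s := by positivity
        linarith
      · have h1 := hbig y r hr hrr
        have h2 := (hbig₁ y r h).trans (hr' r hr hrr)
        linarith
    · intro y r hr hrr
      rw [measureReal_add_apply]
      push_cast
      have h1 := hsmall y r hr (hrr.trans_le (min_le_left _ _))
      have h2 : ν₁.real (ball y r) ≤ D₁ * b * r ^ δ :=
        (real_le_of_le_smul hD₁.le hνD₁ _).trans (by
          rw [mul_assoc]
          exact mul_le_mul_of_nonneg_left (hm.upper y r hr) hD₁.le)
      have h3 := htb r hr (hrr.trans_le (min_le_right _ _))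
      linarith

/-- The average of `k` relocations. Below `r'` averaging divides `K₀ D` by `k`; above `r'` the
growth is inherited from `μ`, since mass has moved by at most `2 τ`, which a small dilation of the
ball absorbs. -/
theorem RegularMeasure.exists_refinement [CompactSpace Ω] (hm : RegularMeasure m δ a b)
    {E : ℕ → Set Ω} {s κ C t₀ : ℝ} (hs : s < δ) (hκ : 0 < κ) (hC : 0 < C) (ht₀ : 0 < t₀)
    (hE : HasSpreading m E δ s κ C t₀) {μ : Measure Ω} {U : Set Ω} {D : ℝ} (hU : IsOpen U)
    (hμU : μ Uᶜ = 0) (hD : 0 < D) (hμ : μ ≤ ENNReal.ofReal D • m) (N : ℕ) {loss θ ε : ℝ}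
    (hloss : 0 < loss) (hθ : 0 < θ) (hε : 0 < ε) :
    ∃ (ν : Measure Ω) (V : Set Ω) (D' : ℝ),
      IsOpen V ∧ closure V ⊆ U ∩ ⋃ n ≥ N, E n ∧ ν Vᶜ = 0 ∧ 0 < D' ∧ ν ≤ ENNReal.ofReal D' • m ∧
      μ.real univ - loss ≤ ν.real univ ∧
      ∀ y r, 0 < r → ν.real (ball y r) ≤ ε * r ^ s ∨
        ν.real (ball y r) ≤ μ.real (ball y ((1 + θ) * r)) := by
  obtain ⟨K₀, hK₀, H⟩ := hm.exists_sum_relocation hs hκ hC hE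
  have := isFiniteMeasure_of_le_smul hμ
  obtain ⟨r', hr', hrK⟩ := exists_rpow_le_rpow hs (K₀ * D) (half_pos hε)
  -- The bound `4 t₀` admits balls of radius `τ / 4` in `HasSpreading`; the bound `θ r' / 2` gives
  -- `2 τ ≤ θ r` for `r ≥ r'`.
  obtain ⟨τ, hτ, hτζ, hmassG⟩ := exists_closedBall_subset_measure hU hμU hloss
    (ζ := min 1 (min (4 * t₀) (θ * r' / 2))) (by positivity)
  have hτ1 : τ ≤ 1 := (hτζ.trans_le (min_le_left _ _)).le
  have hτ2 : τ ≤ 4 * t₀ := (hτζ.trans_le ((min_le_right _ _).trans (min_le_left _ _))).le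
  have hτ3 : τ ≤ θ * r' / 2 := (hτζ.trans_le ((min_le_right _ _).trans (min_le_right _ _))).le
  obtain ⟨k, hk⟩ := exists_nat_gt (K₀ * D / (ε / 2))
  have hk0 : (0 : ℝ) < k := lt_of_le_of_lt (by positivity) hk
  have hkK : K₀ * D ≤ k * (ε / 2) := ((div_lt_iff₀ (by positivity)).1 hk).le
  obtain ⟨ν, V, D', t, hV, hVU, hνV, hD', hνD, hmass, hmove, -, hbig, -⟩ :=
    H μ U D τ hD hμ hτ hτ1 (by linarith) N (ε / 2) r' (half_pos hε) hrK k
  have hreal : ∀ A, (ENNReal.ofReal (1 / k) • ν).real A = 1 / k * ν.real A := fun A => by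
    rw [measureReal_ennreal_smul_apply, ENNReal.toReal_ofReal (by positivity)]
  refine ⟨ENNReal.ofReal (1 / k) • ν, V, 1 / k * D', hV, hVU, by simp [hνV], by positivity, ?_, ?_,
    fun y r hr => ?_⟩
  · rw [ENNReal.ofReal_mul (by positivity), mul_smul]
    gcongr
  · rw [hreal]
    calc μ.real univ - loss ≤ 1 / k * (k * μ.real {x | closedBall x (3 * τ) ⊆ U}) := by
          rw [← mul_assoc, one_div_mul_cancel hk0.ne', one_mul]
          exact hmassG
      _ ≤ _ := by gcongr
  · rw [hreal]
    rcases lt_or_ge r r' with h | h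
    · left
      calc 1 / k * ν.real (ball y r) ≤ 1 / k * ((k * (ε / 2) + k * (ε / 2)) * r ^ s) := by
            have := hbig y r hr h
            have h2 : (k * (ε / 2) + K₀ * D) * r ^ s ≤ (k * (ε / 2) + k * (ε / 2)) * r ^ s := by
              gcongr
            gcongr
            exact this.trans h2
        _ = ε * r ^ s := by field_simp; ring
    · right
      calc 1 / k * ν.real (ball y r) ≤ 1 / k * (k * μ.real (ball y (r + 2 * τ))) := by
            have := hmove y r hr
            gcongr
        _ = μ.real (ball y (r + 2 * τ)) := by
            rw [← mul_assoc, one_div_mul_cancel hk0.ne', one_mul]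
        _ ≤ _ := by
            refine measureReal_mono (ball_subset_ball ?_)
            nlinarith

end Refine

/-! ### Mass distribution without a limit measure -/

section MassDistribution

variable {Ω : Type*} [MetricSpace Ω] [MeasurableSpace Ω] {m : Measure Ω} {δ a b : ℝ}

/-- A measure of bounded density carried by the open set `U`, with more than half of the mass and
with `μ (ball y r) ≤ ε (A r) ^ s` at small scales. -/
structure IsMassState (m : Measure Ω) (s ε R₀ : ℝ) (μ : Measure Ω) (U : Set Ω) (D A : ℝ) :
    Prop where
  isOpen : IsOpen U
  compl : μ Uᶜ = 0
  density_pos : 0 < D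
  density : μ ≤ ENNReal.ofReal D • m
  half_lt : 1 / 2 < μ.real univ
  one_le : 1 ≤ A
  lt_two : A < 2
  growth : ∀ y r, 0 < r → A * r ≤ R₀ → μ.real (ball y r) ≤ ε * (A * r) ^ s

variable [IsProbabilityMeasure m]

theorem RegularMeasure.exists_isMassState (hm : RegularMeasure m δ a b) {s ε : ℝ} (hs : s < δ)
    (hε : 0 < ε) : ∃ R₀ > 0, IsMassState m s ε R₀ m univ 1 1 := by
  obtain ⟨r', hr', H⟩ := exists_rpow_le_rpow hs b hε
  refine ⟨r' / 2, half_pos hr', isOpen_univ, by simp, one_pos, by simp, by simp; norm_num, le_rfl,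
    by norm_num, fun y r hr hrR => ?_⟩
  rw [one_mul] at hrR ⊢
  exact (hm.upper y r hr).trans (H r hr (by linarith))

/-- The enlargement is a ball centred in `T` of radius just above `diam T`, chosen before the
measure: this is possible because the growth bound and the scale `R₀` are common to all mass states.
The error `e` also covers sets of diameter zero. -/
theorem exists_open_superset_growth [CompactSpace Ω] {s ε R₀ : ℝ} (hs0 : 0 ≤ s) (hε : 0 < ε)
    (hR₀ : 0 < R₀) (T : Set Ω) (hT : ediam T ≤ ENNReal.ofReal (R₀ / 4)) {e : ℝ≥0} (he : 0 < e) :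
    ∃ O, IsOpen O ∧ T ⊆ O ∧ ∀ μ U D A, IsMassState m s ε R₀ μ U D A →
      μ O ≤ ENNReal.ofReal (ε * 2 ^ s) * ((⨆ _ : T.Nonempty, ediam T ^ s) + e) := by
  rcases T.eq_empty_or_nonempty with rfl | hne
  · exact ⟨∅, isOpen_empty, subset_rfl, by simp⟩
  obtain ⟨y, hy⟩ := hne
  have hfin : ediam T ≠ ⊤ := ne_top_of_le_ne_top ENNReal.ofReal_ne_top hT
  have hb : Bornology.IsBounded T := isBounded_iff_ediam_ne_top.2 hfin
  have hdiam : diam T ≤ R₀ / 4 := ENNReal.toReal_le_of_le_ofReal (by positivity) hT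
  have hcont : Tendsto (fun x : ℝ => x ^ s) (𝓝[>] (diam T)) (𝓝 (diam T ^ s)) :=
    (Real.continuousAt_rpow_const _ s (Or.inr hs0)).tendsto.mono_left nhdsWithin_le_nhds
  have he' : (0 : ℝ) < e := by exact_mod_cast he
  have h1 := hcont.eventually (gt_mem_nhds (show diam T ^ s < diam T ^ s + e by linarith))
  have h2 : ∀ᶠ x in 𝓝[>] (diam T), x < R₀ / 2 :=
    (gt_mem_nhds (by linarith : diam T < R₀ / 2)).filter_mono nhdsWithin_le_nhds
  obtain ⟨r, ⟨hr1, hr2⟩, hr3⟩ := ((h1.and h2).and self_mem_nhdsWithin).exists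
  have hr3 : diam T < r := hr3
  have hr0 : 0 < r := diam_nonneg.trans_lt hr3
  refine ⟨ball y r, isOpen_ball, fun x hx => (dist_le_diam_of_mem hb hx hy).trans_lt hr3,
    fun μ U D A h => ?_⟩
  have := isFiniteMeasure_of_le_smul h.density
  have hA := h.lt_two
  have hA1 := h.one_le
  have hed : ediam T ^ s = ENNReal.ofReal (diam T ^ s) := by
    rw [← ENNReal.ofReal_rpow_of_nonneg diam_nonneg hs0, diam, ENNReal.ofReal_toReal hfin]
  rw [iSup_pos ⟨y, hy⟩, hed, ← ENNReal.ofReal_coe_nnreal (p := e), ← ENNReal.ofReal_add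
    (by positivity) he'.le, ← ENNReal.ofReal_mul (by positivity), ← ofReal_measureReal]
  refine ENNReal.ofReal_le_ofReal ?_
  calc μ.real (ball y r) ≤ ε * (A * r) ^ s := h.growth y r hr0 (by nlinarith)
    _ ≤ ε * (2 * r) ^ s := by gcongr
    _ = ε * 2 ^ s * r ^ s := by rw [Real.mul_rpow (by norm_num) hr0.le]; ring
    _ ≤ ε * 2 ^ s * (diam T ^ s + e) := by gcongr

variable [BorelSpace Ω]

/-- The dilation `A` moves to the midpoint of `A` and `2`, and the loss is half of the mass in
excess of `1/2`. Both strict bounds thus survive indefinitely. -/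
theorem IsMassState.exists_next [CompactSpace Ω] (hm : RegularMeasure m δ a b)
    {E : ℕ → Set Ω} {s κ C t₀ : ℝ} (hs0 : 0 ≤ s) (hs : s < δ) (hκ : 0 < κ) (hC : 0 < C)
    (ht₀ : 0 < t₀) (hE : HasSpreading m E δ s κ C t₀) {ε R₀ : ℝ} (hε : 0 < ε)
    {μ : Measure Ω} {U : Set Ω} {D A : ℝ} (h : IsMassState m s ε R₀ μ U D A) (N : ℕ) :
    ∃ ν V D' A', IsMassState m s ε R₀ ν V D' A' ∧ closure V ⊆ U ∩ ⋃ n ≥ N, E n := by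
  have hA0 : 0 < A := by linarith [h.one_le]
  have hA2 := h.lt_two
  have hhalf := h.half_lt
  obtain ⟨ν, V, D', hV, hVU, hνV, hD', hνD, hmass, hgrow⟩ :=
    hm.exists_refinement hs hκ hC ht₀ hE h.isOpen h.compl h.density_pos h.density N
      (loss := (μ.real univ - 1 / 2) / 2) (θ := (2 / A - 1) / 2) (by linarith)
      (half_pos (sub_pos.2 ((one_lt_div hA0).2 hA2))) hε
  have hθ : 0 < (2 / A - 1) / 2 := half_pos (sub_pos.2 ((one_lt_div hA0).2 hA2))
  have hA' : A * (1 + (2 / A - 1) / 2) = (A + 2) / 2 := by field_simp; ring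
  refine ⟨ν, V, D', (A + 2) / 2, ⟨hV, hνV, hD', hνD, by linarith, by linarith [h.one_le],
    by linarith, fun y r hr hrR => ?_⟩, hVU⟩
  rcases hgrow y r hr with h1 | h1
  · refine h1.trans ?_
    have : r ≤ (A + 2) / 2 * r := by nlinarith [h.one_le]
    gcongr
  · refine h1.trans ?_
    have h2 := h.growth y ((1 + (2 / A - 1) / 2) * r) (by positivity)
      (by rw [← mul_assoc, hA']; exact hrR)
    rwa [← mul_assoc, hA'] at h2

theorem RegularMeasure.hausdorffMeasure_limsup_eq_top [CompactSpace Ω]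
    (hm : RegularMeasure m δ a b) {E : ℕ → Set Ω} {s κ C t₀ : ℝ} (hs0 : 0 ≤ s) (hs : s < δ)
    (hκ : 0 < κ) (hC : 0 < C) (ht₀ : 0 < t₀) (hE : HasSpreading m E δ s κ C t₀) :
    Measure.hausdorffMeasure s {x | ∃ᶠ n in atTop, x ∈ E n} = ⊤ := by
  have key : ∀ ε : ℝ, 0 < ε → ENNReal.ofReal (1 / 2) ≤ ENNReal.ofReal (ε * 2 ^ s) *
      (Measure.hausdorffMeasure s {x | ∃ᶠ n in atTop, x ∈ E n} + 1) := by
    intro ε hε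
    obtain ⟨R₀, hR₀, hinit⟩ := hm.exists_isMassState hs hε
    let St := {q : Measure Ω × Set Ω × ℝ × ℝ // IsMassState m s ε R₀ q.1 q.2.1 q.2.2.1 q.2.2.2}
    have hstep : ∀ (N : ℕ) (q : St), ∃ q' : St, closure q'.1.2.1 ⊆ q.1.2.1 ∩ ⋃ n ≥ N, E n := by
      rintro N ⟨⟨μ, U, D, A⟩, h⟩
      obtain ⟨ν, V, D', A', h', hVU⟩ := h.exists_next hm hs0 hs hκ hC ht₀ hE hε N
      exact ⟨⟨⟨ν, V, D', A'⟩, h'⟩, hVU⟩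
    choose next hnext using hstep
    let q : ℕ → St := fun k => Nat.rec ⟨⟨m, univ, 1, 1⟩, hinit⟩ next k
    have hq : ∀ k, closure (q (k + 1)).1.2.1 ⊆ (q k).1.2.1 ∩ ⋃ n ≥ k, E n := fun k =>
      hnext k (q k)
    set K : ℕ → Set Ω := fun k => closure (q (k + 1)).1.2.1 with hK
    have hKanti : Antitone K := antitone_nat_of_succ_le fun k =>
      (hq (k + 1)).trans (inter_subset_left.trans subset_closure)
    have hKL : ⋂ k, K k ⊆ {x | ∃ᶠ n in atTop, x ∈ E n} := by
      intro x hx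
      refine frequently_atTop.2 fun N => ?_
      obtain ⟨n, hn, hxn⟩ := mem_iUnion₂.1 ((hq N) (mem_iInter.1 hx N)).2
      exact ⟨n, hn, hxn⟩
    obtain ⟨e, he, hesum⟩ := ENNReal.exists_pos_sum_of_countable (ε := 1) one_ne_zero ℕ
    rw [Measure.hausdorffMeasure_apply]
    have hcover : ∀ t : ℕ → Set Ω, {x | ∃ᶠ n in atTop, x ∈ E n} ⊆ ⋃ n, t n →
        (∀ n, ediam (t n) ≤ ENNReal.ofReal (R₀ / 4)) →
        ENNReal.ofReal (1 / 2) ≤ ENNReal.ofReal (ε * 2 ^ s) *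
          ((∑' n, ⨆ _ : (t n).Nonempty, ediam (t n) ^ s) + 1) := by
      intro t ht hdiam
      choose O hO htO hOm using fun n =>
        exists_open_superset_growth (m := m) hs0 hε hR₀ (t n) (hdiam n) (he n)
      -- Compactness stands in for a weak limit: the nested compact sets `K k` have intersection
      -- inside the open cover, so one of them already is, and its own measure is tested against the
      -- cover.
      obtain ⟨k, hk⟩ := exists_subset_nhds_of_isCompact (V := K) (U := ⋃ n, O n)
        hKanti.directed_ge (fun k => isClosed_closure.isCompact) (fun x hx =>
          (isOpen_iUnion hO).mem_nhds (iUnion_mono htO (ht (hKL hx))))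
      have hst := (q (k + 1)).2
      set μ := (q (k + 1)).1.1
      have hμf := isFiniteMeasure_of_le_smul hst.density
      calc ENNReal.ofReal (1 / 2) ≤ ENNReal.ofReal (μ.real univ) :=
            ENNReal.ofReal_le_ofReal hst.half_lt.le
        _ = μ univ := ofReal_measureReal
        _ = μ (q (k + 1)).1.2.1 := (measure_of_measure_compl_eq_zero hst.compl).symm
        _ ≤ μ (⋃ n, O n) := measure_mono (subset_closure.trans hk)
        _ ≤ ∑' n, μ (O n) := measure_iUnion_le _
        _ ≤ ∑' n, ENNReal.ofReal (ε * 2 ^ s) *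
            ((⨆ _ : (t n).Nonempty, ediam (t n) ^ s) + e n) :=
          ENNReal.tsum_le_tsum fun n => hOm n _ _ _ _ hst
        _ = ENNReal.ofReal (ε * 2 ^ s) *
            ((∑' n, ⨆ _ : (t n).Nonempty, ediam (t n) ^ s) + ∑' n, (e n : ℝ≥0∞)) := by
          rw [ENNReal.tsum_mul_left, ENNReal.tsum_add]
        _ ≤ _ := by gcongr
    have hc0 : ENNReal.ofReal (ε * 2 ^ s) ≠ 0 := by
      simp only [ne_eq, ENNReal.ofReal_eq_zero, not_le]
      positivity
    rw [mul_comm, ← ENNReal.div_le_iff_le_mul (Or.inl hc0) (Or.inl ENNReal.ofReal_ne_top)]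
    refine tsub_le_iff_right.1 (le_iSup₂_of_le (ENNReal.ofReal (R₀ / 4)) (by positivity) ?_)
    refine le_iInf fun t => le_iInf₂ fun ht hd => tsub_le_iff_right.2 ?_
    rw [ENNReal.div_le_iff_le_mul (Or.inl hc0) (Or.inl ENNReal.ofReal_ne_top), mul_comm]
    exact hcover t ht hd
  by_contra hne
  set M := Measure.hausdorffMeasure s {x | ∃ᶠ n in atTop, x ∈ E n}
  have hM : M + 1 ≠ ⊤ := ENNReal.add_ne_top.2 ⟨hne, ENNReal.one_ne_top⟩
  have hMpos : 0 < (M + 1).toReal := ENNReal.toReal_pos (by simp) hM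
  have h2 : (0 : ℝ) < 2 ^ s := by positivity
  -- This `ε` turns the right-hand side of `key` into `1 / 4`.
  have := key (1 / (4 * 2 ^ s * (M + 1).toReal)) (by positivity)
  rw [← ENNReal.ofReal_toReal hM, ← ENNReal.ofReal_mul (by positivity),
    ENNReal.ofReal_le_ofReal_iff (by positivity)] at this
  rw [ENNReal.ofReal_toReal hM] at this
  have h3 : 1 / (4 * 2 ^ s * (M + 1).toReal) * 2 ^ s * (M + 1).toReal = 1 / 4 := by
    field_simp
  linarith

end MassDistribution

/-! ### Resonant pieces inside one index block -/

section Blocks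

variable {Ω : Type*} [MetricSpace Ω] {J : Type*}

/-- The points approximated at rate `ψ` by some resonant set with index in the `n`-th block. -/
def blockSet (R : J → Set Ω) (β : J → ℝ) (ψ : ℝ → ℝ) (l u : ℕ → ℝ) (n : ℕ) : Set Ω :=
  ⋃ α ∈ indexBlock β l u n, thickening (ψ (β α)) (R α)

theorem frequently_blockSet_subset_limsupSet {R : J → Set Ω} {β : J → ℝ} {ψ : ℝ → ℝ} {l u : ℕ → ℝ}
    (hl : Tendsto l atTop atTop) :
    {x | ∃ᶠ n in atTop, x ∈ blockSet R β ψ l u n} ⊆ limsupSet R β ψ := by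
  intro x hx hfin
  obtain ⟨M, hM⟩ := (hfin.image β).bddAbove
  obtain ⟨n, hxn, hn⟩ := (hx.and_eventually (hl.eventually_ge_atTop M)).exists
  obtain ⟨α, hα, hxα⟩ := mem_iUnion₂.1 hxn
  have := hM (mem_image_of_mem β hxα)
  linarith [hα.1]

variable {R : J → Set Ω} {β : J → ℝ} {ρ ψ : ℝ → ℝ} {l u : ℕ → ℝ}

theorem closure_thickening_subset_blockSet (hψ : IsApproximatingFunction ψ) {n : ℕ} {α : J}
    (hβ : 0 < β α) (hα : α ∈ indexBlock β l u n) {r : ℝ} (hr : r < ψ (u n)) :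
    closure (thickening r (R α)) ⊆ blockSet R β ψ l u n := by
  have hψu : ψ (u n) ≤ ψ (β α) := hψ.anti hβ (hβ.trans_le hα.2) hα.2
  refine (closure_thickening_subset_cthickening _ _).trans ?_
  refine (cthickening_subset_thickening' (hψ.pos _ hβ) (hr.trans_le hψu) _).trans ?_
  exact subset_iUnion₂_of_subset α hα subset_rfl

variable [MeasurableSpace Ω] {m : Measure Ω} {δ γ a b κ : ℝ}

/-- The intersection conditions for the resonant set `A`, at scale `p` and with thickness `t`. -/
structure HasIntersectionBounds (m : Measure Ω) (A : Set Ω) (p γ c₁ c₂ t : ℝ) : Prop where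
  lower : ∀ c ∈ A, c₁ * m.real (ball c t) * (p / t) ^ γ ≤
    m.real (ball c (p / 2) ∩ thickening t A)
  upper : ∀ c ∈ A, ∀ x ∈ A, ∀ r, 0 < r → r ≤ 3 * p →
    m.real (ball x r ∩ ball c (3 * p) ∩ thickening (3 * t) A) ≤
      c₂ * m.real (ball c t) * (r / t) ^ γ

variable {A : Set Ω} {p c₁ c₂ t : ℝ}

theorem HasIntersectionBounds.lower_rpow (hA : HasIntersectionBounds m A p γ c₁ c₂ t)
    (hm : RegularMeasure m δ a b) (hc₁ : 0 < c₁) (hp : 0 < p) (ht : 0 < t) (ht1 : t ≤ 1)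
    {c : Ω} (hc : c ∈ A) :
    c₁ * a * (t ^ (δ - γ) * p ^ γ) ≤ m.real (ball c (p / 2) ∩ thickening t A) := by
  refine le_trans ?_ (hA.lower c hc)
  calc c₁ * a * (t ^ (δ - γ) * p ^ γ) = c₁ * (a * t ^ δ) * (p / t) ^ γ := by
        rw [Real.rpow_sub ht, Real.div_rpow hp.le ht.le]
        field_simp
    _ ≤ _ := by
        have := hm.lower c t ht ht1
        gcongr

variable [IsProbabilityMeasure m]

/-- For a maximal `3 p`-separated set of resonant points, the balls of radius `4 p` cover the part
of the ubiquity union in `ball x t`: a point there is within `p` of a resonant point. Comparing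
measures bounds the cardinality from below. -/
theorem RegularMeasure.exists_resonant_centres [CompactSpace Ω] (hm : RegularMeasure m δ a b)
    {n : ℕ} (hp : 0 < ρ (u n)) (hκ : 0 < κ) {x : Ω} {t : ℝ} (ht : 0 < t) (ht1 : t ≤ 1)
    (hub : κ * m.real (ball x t) ≤ m.real (ball x t ∩ ubiquityUnion R β ρ l u n)) :
    ∃ Z : Finset Ω, (∀ c ∈ Z, c ∈ ball x (t + ρ (u n))) ∧
      (∀ c ∈ Z, ∃ α ∈ indexBlock β l u n, c ∈ R α) ∧
      (∀ c ∈ Z, ∀ c' ∈ Z, c ≠ c' → 3 * ρ (u n) ≤ dist c c') ∧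
      κ * a / (b * 4 ^ δ) * t ^ δ ≤ Z.card * ρ (u n) ^ δ := by
  have hb := hm.upper_pos
  set p := ρ (u n)
  obtain ⟨Z, hZT, hZsep, hZcov⟩ := exists_separated_finset
    {c | c ∈ ball x (t + p) ∧ ∃ α ∈ indexBlock β l u n, c ∈ R α} (by positivity : 0 < 3 * p)
  refine ⟨Z, fun c hc => (hZT hc).1, fun c hc => (hZT hc).2,
    fun c hc c' hc' h => (hZsep c hc c' hc' h).le, ?_⟩
  have hsub : ball x t ∩ ubiquityUnion R β ρ l u n ⊆ ⋃ c ∈ Z, ball c (4 * p) := by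
    rintro y ⟨hy, hyu⟩
    obtain ⟨α, hα, hyα⟩ := mem_iUnion₂.1 hyu
    obtain ⟨c, hc, hyc⟩ := mem_thickening_iff.1 hyα
    have hyx := mem_ball.1 hy
    have hcx : c ∈ ball x (t + p) := by
      rw [mem_ball]
      linarith [dist_triangle_left c x y]
    obtain ⟨z, hz, hcz⟩ := hZcov c ⟨hcx, α, hα, hc⟩
    refine mem_biUnion (x := z) hz ?_
    rw [mem_ball]
    linarith [dist_triangle y c z]
  have h1 : κ * (a * t ^ δ) ≤ Z.card * (b * (4 * p) ^ δ) := calc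
    κ * (a * t ^ δ) ≤ κ * m.real (ball x t) := by
        have := hm.lower x t ht ht1
        gcongr
    _ ≤ m.real (ball x t ∩ ubiquityUnion R β ρ l u n) := hub
    _ ≤ m.real (⋃ c ∈ Z, ball c (4 * p)) := measureReal_mono hsub (measure_ne_top _ _)
    _ ≤ ∑ c ∈ Z, m.real (ball c (4 * p)) := measureReal_biUnion_finset_le _ _
    _ ≤ ∑ c ∈ Z, b * (4 * p) ^ δ := Finset.sum_le_sum fun c _ => hm.upper _ _ (by positivity)
    _ = _ := by simp
  rw [Real.mul_rpow (by norm_num) hp.le] at h1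
  rw [div_mul_eq_mul_div, div_le_iff₀ (by positivity)]
  linarith

/-- Both ranges of `r` give the numerator bound `B r ^ s t ^ (δ - s)`: for `r < t` from regularity
and `s ≤ δ`, for `r ≥ t` from the upper intersection condition and `γ ≤ s`. The lower condition
bounds the measure of the piece, and `hM` converts the powers of `p` and `t` left over. -/
theorem HasIntersectionBounds.growth (hA : HasIntersectionBounds m A p γ c₁ c₂ t)
    (hm : RegularMeasure m δ a b) (hc₁ : 0 < c₁) (hc₂ : 0 < c₂) (ht : 0 < t)
    (ht1 : t ≤ 1) (htp : t ≤ p) {s M : ℝ} (hγs : γ ≤ s) (hsδ : s ≤ δ)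
    (hM : p ^ (δ - γ) ≤ M * t ^ (s - γ)) {c : Ω} (hc : c ∈ A) {y : Ω} {r : ℝ} (hr : 0 < r)
    (hrp : r ≤ p) :
    m.real (ball y r ∩ (ball c (p / 2) ∩ thickening t A)) * p ^ δ ≤
      M * (b * max 1 (c₂ * 3 ^ γ)) / (c₁ * a) * r ^ s *
        m.real (ball c (p / 2) ∩ thickening t A) := by
  have ha := hm.lower_pos
  have hb := hm.upper_pos
  have hp : 0 < p := ht.trans_le htp
  set B := b * max 1 (c₂ * 3 ^ γ) with hB
  have hB0 : 0 < B := by positivity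
  have hM0 : 0 < M := pos_of_mul_pos_left ((Real.rpow_pos_of_pos hp _).trans_le hM)
    (Real.rpow_pos_of_pos ht _).le
  have key : m.real (ball y r ∩ (ball c (p / 2) ∩ thickening t A)) ≤ B * (r ^ s * t ^ (δ - s)) := by
    rcases lt_or_ge r t with h | h
    · calc m.real (ball y r ∩ (ball c (p / 2) ∩ thickening t A)) ≤ m.real (ball y r) :=
            measureReal_mono inter_subset_left
        _ ≤ b * r ^ δ := hm.upper y r hr
        _ = b * (r ^ s * r ^ (δ - s)) := by rw [← Real.rpow_add hr]; ring_nf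
        _ ≤ b * (r ^ s * t ^ (δ - s)) := by
            have : 0 ≤ δ - s := by linarith
            gcongr
        _ ≤ B * (r ^ s * t ^ (δ - s)) := by
            gcongr
            exact le_mul_of_one_le_right hb.le (le_max_left _ _)
    · rcases (ball y r ∩ (ball c (p / 2) ∩ thickening t A)).eq_empty_or_nonempty with h0 | h0
      · rw [h0, measureReal_empty]
        positivity
      · obtain ⟨w, hwy, -, hwA⟩ := h0
        obtain ⟨z, hz, hwz⟩ := mem_thickening_iff.1 hwA
        -- The upper condition needs a ball centred on `A`. Recentring at `z` costs `r + r + t ≤ 3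
        -- r`, and `3 r ≤ 3 p` is exactly the range allowed there.
        have hsub : ball y r ∩ (ball c (p / 2) ∩ thickening t A) ⊆
            ball z (3 * r) ∩ ball c (3 * p) ∩ thickening (3 * t) A := by
          rintro v ⟨hvy, hvc, hvA⟩
          refine ⟨⟨?_, ball_subset_ball (by linarith) hvc⟩, thickening_mono (by linarith) A hvA⟩
          have h1 := mem_ball.1 hvy
          have h2 := mem_ball'.1 hwy
          rw [mem_ball]
          linarith [dist_triangle4 v y w z]
        calc m.real (ball y r ∩ (ball c (p / 2) ∩ thickening t A))
            ≤ m.real (ball z (3 * r) ∩ ball c (3 * p) ∩ thickening (3 * t) A) :=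
              measureReal_mono hsub
          _ ≤ c₂ * m.real (ball c t) * (3 * r / t) ^ γ :=
              hA.upper c hc z hz _ (by positivity) (by linarith)
          _ ≤ c₂ * (b * t ^ δ) * (3 * r / t) ^ γ := by
              have := hm.upper c t ht
              gcongr
          _ = b * (c₂ * 3 ^ γ) * (r ^ γ * t ^ (δ - γ)) := by
              rw [Real.rpow_sub ht, Real.div_rpow (by positivity) ht.le,
                Real.mul_rpow (by norm_num) hr.le]
              field_simp
          _ ≤ B * (r ^ γ * t ^ (δ - γ)) := by
              refine mul_le_mul_of_nonneg_right ?_ (by positivity)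
              exact mul_le_mul_of_nonneg_left (le_max_right _ _) hb.le
          _ ≤ B * (r ^ s * t ^ (δ - s)) := by
              have h1 : r ^ s = r ^ γ * r ^ (s - γ) := by rw [← Real.rpow_add hr]; ring_nf
              have h2 : t ^ (δ - γ) = t ^ (s - γ) * t ^ (δ - s) := by
                rw [← Real.rpow_add ht]; ring_nf
              have h3 : t ^ (s - γ) ≤ r ^ (s - γ) := Real.rpow_le_rpow ht.le h (by linarith)
              refine mul_le_mul_of_nonneg_left ?_ hB0.le
              rw [h1, h2, mul_assoc]
              gcongr
  have hlow := hA.lower_rpow hm hc₁ hp ht ht1 hc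
  calc m.real (ball y r ∩ (ball c (p / 2) ∩ thickening t A)) * p ^ δ
      ≤ B * (r ^ s * t ^ (δ - s)) * p ^ δ := by gcongr
    _ = B * r ^ s * t ^ (δ - s) * p ^ γ * p ^ (δ - γ) := by
        rw [mul_assoc _ (p ^ γ), ← Real.rpow_add hp]; ring_nf
    _ ≤ B * r ^ s * t ^ (δ - s) * p ^ γ * (M * t ^ (s - γ)) := by gcongr
    _ = M * B / (c₁ * a) * r ^ s * (c₁ * a * (t ^ (δ - γ) * p ^ γ)) := by
        have h2 : t ^ (δ - γ) = t ^ (s - γ) * t ^ (δ - s) := by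
          rw [← Real.rpow_add ht]; ring_nf
        rw [h2]
        field_simp
    _ ≤ _ := by gcongr

end Blocks

/-! ### Infinite Hausdorff measure and positive measure of the limsup set -/

section LowerBounds

theorem measure_frequently_pos {X : Type*} [MeasurableSpace X] {m : Measure X} [IsFiniteMeasure m]
    {E : ℕ → Set X} (hE : ∀ n, MeasurableSet (E n)) {c : ℝ} (hc : 0 < c)
    (h : ∃ᶠ n in atTop, c ≤ m.real (E n)) : 0 < m {x | ∃ᶠ n in atTop, x ∈ E n} := by
  have heq : {x | ∃ᶠ n in atTop, x ∈ E n} = ⋂ N, ⋃ n ≥ N, E n := by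
    ext x
    simp [frequently_atTop]
  have hanti : Antitone fun N => ⋃ n ≥ N, E n := fun i j hij =>
    biUnion_mono (fun n (hn : j ≤ n) => hij.trans hn) fun _ _ => subset_rfl
  have htend := tendsto_measure_iInter_atTop (μ := m) (s := fun N => ⋃ n ≥ N, E n)
    (fun N => (MeasurableSet.biUnion (to_countable _) fun n _ => hE n).nullMeasurableSet) hanti
    ⟨0, measure_ne_top _ _⟩
  rw [heq]
  refine lt_of_lt_of_le (ENNReal.ofReal_pos.2 hc) (ge_of_tendsto' htend fun N => ?_)
  obtain ⟨n, hn, hcn⟩ := frequently_atTop.1 h N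
  calc ENNReal.ofReal c ≤ ENNReal.ofReal (m.real (E n)) := ENNReal.ofReal_le_ofReal hcn
    _ = m (E n) := ofReal_measureReal
    _ ≤ _ := measure_mono (subset_iUnion₂_of_subset n hn subset_rfl)

variable {Ω : Type*} [MetricSpace Ω] [MeasurableSpace Ω] {J : Type*} {m : Measure Ω}
  {R : J → Set Ω} {β : J → ℝ} {ρ ψ : ℝ → ℝ} {l u : ℕ → ℝ} {δ γ a b : ℝ}

theorem IsLowerUpper.upper_tendsto (h : IsLowerUpper l u) : Tendsto u atTop atTop :=
  tendsto_atTop_mono (fun n => (h.lt n).le) h.lower_tendsto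

theorem IntersectionConditions.eventually_hasIntersectionBounds
    (h : IntersectionConditions m R β ρ u γ) :
    ∃ c₁ c₂ : ℝ, 0 < c₁ ∧ 0 < c₂ ∧ ∀ᶠ n in atTop, ∀ α ∈ indexBlock β l u n, ∀ t, 0 < t →
      t ≤ ρ (u n) → HasIntersectionBounds m (R α) (ρ (u n)) γ c₁ c₂ t := by
  obtain ⟨-, -, c₁, c₂, hc₁, hc₂, n₀, H⟩ := h
  refine ⟨c₁, c₂, hc₁, hc₂, (eventually_ge_atTop n₀).mono fun n hn α hα t ht htp => ⟨?_, ?_⟩⟩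
  · exact fun c hc => (H n hn α hα.2 c hc t ht htp).1
  · exact fun c hc x hx r hr hrp => (H n hn α hα.2 c hc t ht htp).2 α x hx r hr hrp

variable [IsProbabilityMeasure m]

theorem IsLocallyUbiquitous.hasSpreading [Nonempty J] [CompactSpace Ω] (hm : RegularMeasure m δ a b)
    (hβ : IsWeight β) (hlu : IsLowerUpper l u) (hρ : IsUbiquityFunction ρ)
    (hψ : IsApproximatingFunction ψ) (hub : IsLocallyUbiquitous m R β ρ l u γ)
    (hlim : Tendsto (fun n => ψ (u n) / ρ (u n)) atTop (𝓝 0)) {s M : ℝ} (hγs : γ ≤ s)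
    (hsδ : s ≤ δ) (hM : 0 < M)
    (hfreq : ∃ᶠ n in atTop, ρ (u n) ^ (δ - γ) ≤ M * (ψ (u n) / 2) ^ (s - γ)) :
    ∃ κ C t₀, 0 < κ ∧ 0 < C ∧ 0 < t₀ ∧ HasSpreading m (blockSet R β ψ l u) δ s κ C t₀ := by
  classical
  obtain ⟨⟨κ, r₀, hκ, hr₀, hloc⟩, hint⟩ := hub
  obtain ⟨c₁, c₂, hc₁, hc₂, hbounds⟩ := hint.eventually_hasIntersectionBounds (l := l)
  have ha := hm.lower_pos
  have hb := hm.upper_pos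
  refine ⟨κ * a / (b * 4 ^ δ), M * (b * max 1 (c₂ * 3 ^ γ)) / (c₁ * a), min r₀ 1, by positivity,
    by positivity, by positivity, fun X t ht htt N η hη => ?_⟩
  have hloc' : ∀ᶠ n in atTop, ∀ x ∈ X,
      κ * m.real (ball x t) ≤ m.real (ball x t ∩ ubiquityUnion R β ρ l u n) := by
    rw [Finset.eventually_all]
    intro x _
    obtain ⟨n₀, hn₀⟩ := hloc x t ht (htt.trans (min_le_left _ _))
    exact (eventually_ge_atTop n₀).mono hn₀
  have hρ0 : ∀ᶠ n in atTop, ρ (u n) < min η 1 :=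
    (hρ.tendsto_zero.comp hlu.upper_tendsto).eventually (gt_mem_nhds (by positivity))
  obtain ⟨n, hn, ⟨⟨⟨hbd, hlocn⟩, hρn⟩, hψρ⟩, hNn⟩ := (hfreq.and_eventually
    ((((hbounds.and hloc').and hρ0).and (hlim.eventually (gt_mem_nhds one_pos))).and
      (eventually_ge_atTop N))).exists
  have hun := hlu.upper_pos n
  have hp := hρ.pos _ hun
  have hψn := hψ.pos _ hun
  have hp1 : ρ (u n) < 1 := hρn.trans_le (min_le_right _ _)
  have hψp : ψ (u n) < ρ (u n) := (div_lt_one hp).1 hψρ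
  choose! α hα hcα using fun (c : Ω) (h : ∃ α ∈ indexBlock β l u n, c ∈ R α) => h
  -- Half of `ψ (u n)` is used so that closures of the pieces still lie in the open neighbourhoods
  -- forming `blockSet`.
  refine ⟨n, hNn, ρ (u n), hp, hρn.trans_le (min_le_left _ _),
    fun c => ball c (ρ (u n) / 2) ∩ thickening (ψ (u n) / 2) (R (α c)), fun x hx => ?_⟩
  obtain ⟨Z, hZball, hZR, hZsep, hZcard⟩ :=
    hm.exists_resonant_centres hp hκ ht (htt.trans (min_le_right _ _)) (hlocn x hx)
  refine ⟨Z, hZball, hZsep, hZcard, fun c hc => ?_⟩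
  have hA := hbd (α c) (hα c (hZR c hc)) (ψ (u n) / 2) (by positivity) (by linarith)
  have hcR := hcα c (hZR c hc)
  refine ⟨isOpen_ball.inter isOpen_thickening, inter_subset_left, ?_, ?_, fun y r hr hrp => ?_⟩
  · refine (closure_mono inter_subset_right).trans ?_
    exact closure_thickening_subset_blockSet hψ (hβ.pos _) (hα c (hZR c hc)) (by linarith)
  · refine lt_of_lt_of_le ?_ (hA.lower_rpow hm hc₁ hp (by positivity) (by linarith) hcR)
    positivity
  · exact hA.growth hm hc₁ hc₂ (by positivity) (by linarith) (by linarith) hγs hsδ hn hcR hr hrp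

variable [BorelSpace Ω]

theorem IsLocallyUbiquitous.hausdorffMeasure_eq_top [Nonempty J] [CompactSpace Ω]
    (hm : RegularMeasure m δ a b)
    (hβ : IsWeight β) (hlu : IsLowerUpper l u) (hρ : IsUbiquityFunction ρ)
    (hψ : IsApproximatingFunction ψ) (hub : IsLocallyUbiquitous m R β ρ l u γ) (hγδ : γ < δ)
    (hlim : Tendsto (fun n => ψ (u n) / ρ (u n)) atTop (𝓝 0)) {τ C : ℝ} (hτ : 0 ≤ τ) (hτ1 : τ < 1)
    (hC : 0 < C) (hfreq : ∃ᶠ n in atTop, ρ (u n) ≤ C * ψ (u n) ^ τ) :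
    Measure.hausdorffMeasure (γ + τ * (δ - γ)) (limsupSet R β ψ) = ⊤ := by
  have hδγ : 0 < δ - γ := sub_pos.2 hγδ
  have hγ : 0 ≤ γ := hub.2.1
  have h0 : 0 ≤ τ * (δ - γ) := by positivity
  have h1 : γ + τ * (δ - γ) < δ := by nlinarith
  -- The factor `2 ^ τ` in `M` compensates for the halved thickness `ψ (u n) / 2`.
  obtain ⟨κ, C', t₀, hκ, hC', ht₀, hE⟩ := hub.hasSpreading hm hβ hlu hρ hψ hlim
    (s := γ + τ * (δ - γ)) (M := (C * 2 ^ τ) ^ (δ - γ)) (by linarith) h1.le (by positivity) (by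
      refine hfreq.mono fun n hn => ?_
      have hp := hρ.pos _ (hlu.upper_pos n)
      have hψn := hψ.pos _ (hlu.upper_pos n)
      have h2 : C * ψ (u n) ^ τ = C * 2 ^ τ * (ψ (u n) / 2) ^ τ := by
        rw [Real.div_rpow hψn.le (by norm_num)]
        field_simp
      have h3 : (ψ (u n) / 2) ^ (γ + τ * (δ - γ) - γ) = ((ψ (u n) / 2) ^ τ) ^ (δ - γ) := by
        rw [← Real.rpow_mul (by positivity)]
        ring_nf
      rw [h3, ← Real.mul_rpow (by positivity) (by positivity), ← h2]
      exact Real.rpow_le_rpow hp.le hn hδγ.le)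
  have := hm.hausdorffMeasure_limsup_eq_top (by linarith) h1 hκ hC' ht₀ hE
  exact top_le_iff.1 (this.ge.trans
    (measure_mono (frequently_blockSet_subset_limsupSet hlu.lower_tendsto)))

theorem RegularMeasure.hausdorffMeasure_pos (hm : RegularMeasure m δ a b) {A : Set Ω}
    (hA : 0 < m A) : 0 < Measure.hausdorffMeasure δ A := by
  have hδ := hm.exp_pos
  have hb := hm.upper_pos
  set B := b * 2 ^ δ with hB
  have hB0 : 0 < B := by positivity
  have hle : ENNReal.ofReal B⁻¹ • m ≤ Measure.hausdorffMeasure δ := by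
    refine Measure.le_hausdorffMeasure δ _ 1 one_pos fun T hT => ?_
    rw [Measure.smul_apply, smul_eq_mul]
    rcases T.eq_empty_or_nonempty with rfl | ⟨y, hy⟩
    · simp
    have hfin : ediam T ≠ ⊤ := ne_top_of_le_ne_top ENNReal.one_ne_top hT
    have hbd : Bornology.IsBounded T := isBounded_iff_ediam_ne_top.2 hfin
    have hed : ediam T ^ δ = ENNReal.ofReal (diam T ^ δ) := by
      rw [← ENNReal.ofReal_rpow_of_nonneg diam_nonneg hδ.le, diam, ENNReal.ofReal_toReal hfin]
    rw [hed, ← ofReal_measureReal (μ := m), ← ENNReal.ofReal_mul (by positivity)]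
    refine ENNReal.ofReal_le_ofReal ?_
    rw [inv_mul_le_iff₀ hB0]
    have hev : ∀ r, diam T < r → m.real T ≤ b * r ^ δ := fun r hr =>
      (measureReal_mono fun x hx => (dist_le_diam_of_mem hbd hx hy).trans_lt hr).trans
        (hm.upper y r (diam_nonneg.trans_lt hr))
    have hcont : Tendsto (fun x : ℝ => b * x ^ δ) (𝓝[>] (diam T)) (𝓝 (b * diam T ^ δ)) :=
      ((Real.continuousAt_rpow_const _ δ (Or.inr hδ.le)).tendsto.mono_left
        nhdsWithin_le_nhds).const_mul b
    have h1 := ge_of_tendsto hcont (eventually_mem_nhdsWithin.mono fun r hr => hev r hr)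
    refine h1.trans (mul_le_mul_of_nonneg_right ?_ (Real.rpow_nonneg diam_nonneg _))
    exact le_mul_of_one_le_right hb.le (Real.one_le_rpow (by norm_num) hδ.le)
  refine lt_of_lt_of_le ?_ (hle A)
  rw [Measure.smul_apply, smul_eq_mul]
  exact ENNReal.mul_pos (by positivity) hA.ne'

/-- When `t ^ (δ - γ)` is comparable to `ρ(u_n) ^ (δ - γ)`, each piece of thickness `t` fills a
fixed proportion of `ρ(u_n) ^ δ`. Disjoint pieces then give `m (E n)` a uniform lower bound for
infinitely many `n`, which passes to the limsup set by `measure_frequently_pos`. -/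
theorem IsLocallyUbiquitous.measure_limsupSet_pos [Nonempty J] [CompactSpace Ω]
    (hm : RegularMeasure m δ a b)
    (hβ : IsWeight β) (hlu : IsLowerUpper l u) (hρ : IsUbiquityFunction ρ)
    (hψ : IsApproximatingFunction ψ) (hub : IsLocallyUbiquitous m R β ρ l u γ) {c₀ : ℝ}
    (hc₀ : 0 < c₀) (hfreq : ∃ᶠ n in atTop, ∃ t, 0 < t ∧ t ≤ ρ (u n) ∧ t ≤ ψ (u n) ∧
      c₀ * ρ (u n) ^ (δ - γ) ≤ t ^ (δ - γ)) :
    0 < m (limsupSet R β ψ) := by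
  obtain ⟨⟨κ, r₀, hκ, hr₀, hloc⟩, hint⟩ := hub
  obtain ⟨c₁, c₂, hc₁, hc₂, hbounds⟩ := hint.eventually_hasIntersectionBounds (l := l)
  have ha := hm.lower_pos
  have hb := hm.upper_pos
  obtain ⟨x⟩ : Nonempty Ω := nonempty_of_isProbabilityMeasure m
  set r := min r₀ 1
  have hr : 0 < r := by positivity
  obtain ⟨n₀, hn₀⟩ := hloc x r hr (min_le_left _ _)
  have hρ1 : ∀ᶠ n in atTop, ρ (u n) < 1 :=
    (hρ.tendsto_zero.comp hlu.upper_tendsto).eventually (gt_mem_nhds one_pos)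
  refine (measure_frequently_pos (E := blockSet R β ψ l u) (fun n => (isOpen_biUnion fun α _ =>
    isOpen_thickening).measurableSet) (c := κ * a / (b * 4 ^ δ) * r ^ δ * (c₁ * a * c₀))
    (by positivity) ?_).trans_le
      (measure_mono (frequently_blockSet_subset_limsupSet hlu.lower_tendsto))
  refine (hfreq.and_eventually ((hbounds.and hρ1).and (eventually_ge_atTop n₀))).mono ?_
  rintro n ⟨⟨t, ht, htp, htψ, hc₀t⟩, ⟨hbd, hp1⟩, hn⟩
  have hp := hρ.pos _ (hlu.upper_pos n)
  set p := ρ (u n) with hpdef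
  obtain ⟨Z, -, hZR, hZsep, hZcard⟩ :=
    hm.exists_resonant_centres hp hκ hr (min_le_right _ _) (hn₀ n hn)
  choose! α hα hcα using hZR
  set F : Ω → Set Ω := fun c => ball c (p / 2) ∩ thickening t (R (α c)) with hF
  have hFm : ∀ c ∈ Z, c₁ * a * c₀ * p ^ δ ≤ m.real (F c) := by
    intro c hc
    refine le_trans ?_ ((hbd (α c) (hα c hc) t ht htp).lower_rpow hm hc₁ hp ht
      (by linarith) (hcα c hc))
    have : p ^ δ = p ^ (δ - γ) * p ^ γ := by rw [← Real.rpow_add hp]; ring_nf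
    calc c₁ * a * c₀ * p ^ δ = c₁ * a * (c₀ * p ^ (δ - γ) * p ^ γ) := by rw [this]; ring
      _ ≤ _ := by gcongr
  have hdisj : (Z : Set Ω).PairwiseDisjoint F := by
    intro c hc c' hc' hcc
    refine (ball_disjoint_ball ?_).mono inter_subset_left inter_subset_left
    linarith [hZsep c hc c' hc' hcc]
  calc κ * a / (b * 4 ^ δ) * r ^ δ * (c₁ * a * c₀)
      ≤ Z.card * p ^ δ * (c₁ * a * c₀) := by gcongr
    _ = ∑ c ∈ Z, c₁ * a * c₀ * p ^ δ := by rw [Finset.sum_const, nsmul_eq_mul]; ring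
    _ ≤ ∑ c ∈ Z, m.real (F c) := Finset.sum_le_sum hFm
    _ = m.real (⋃ c ∈ Z, F c) := (measureReal_biUnion_finset hdisj fun c _ =>
        (isOpen_ball.inter isOpen_thickening).measurableSet).symm
    _ ≤ m.real (blockSet R β ψ l u n) := by
        refine measureReal_mono (iUnion₂_subset fun c hc => ?_)
        have hβα := hβ.pos (α c)
        have hψu : ψ (u n) ≤ ψ (β (α c)) :=
          hψ.anti hβα (hβα.trans_le (hα c hc).2) (hα c hc).2
        exact inter_subset_right.trans ((thickening_mono (htψ.trans hψu) _).trans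
          (subset_iUnion₂_of_subset (α c) (hα c hc) subset_rfl))

end LowerBounds

/-! ### The exponent `σ` and comparison of `ρ(u_n)` with powers of `ψ(u_n)` -/

section Exponent

variable {ρ ψ : ℝ → ℝ} {l u : ℕ → ℝ}

theorem eventually_logQuotient_mem_Icc (hlu : IsLowerUpper l u) (hρ : IsUbiquityFunction ρ)
    (hψ : IsApproximatingFunction ψ)
    (hlim : Tendsto (fun n => ψ (u n) / ρ (u n)) atTop (𝓝 0)) :
    ∀ᶠ n in atTop, ψ (u n) < 1 ∧ Real.log (ρ (u n)) / Real.log (ψ (u n)) ∈ Icc (0 : ℝ) 1 := by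
  have hρ1 : ∀ᶠ n in atTop, ρ (u n) < 1 :=
    (hρ.tendsto_zero.comp hlu.upper_tendsto).eventually (gt_mem_nhds one_pos)
  filter_upwards [hρ1, hlim.eventually (gt_mem_nhds one_pos)] with n h1 h2
  have hp := hρ.pos _ (hlu.upper_pos n)
  have hψn := hψ.pos _ (hlu.upper_pos n)
  have h3 : ψ (u n) < ρ (u n) := (div_lt_one hp).1 h2
  have h4 : Real.log (ψ (u n)) < Real.log (ρ (u n)) := Real.log_lt_log hψn h3
  have h5 : Real.log (ρ (u n)) < 0 := Real.log_neg hp h1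
  refine ⟨h3.trans h1, div_nonneg_of_nonpos h5.le (h4.trans h5).le, ?_⟩
  rw [div_le_one_of_neg (h4.trans h5)]
  exact h4.le

theorem logExponent_mem_Icc (hlu : IsLowerUpper l u) (hρ : IsUbiquityFunction ρ)
    (hψ : IsApproximatingFunction ψ)
    (hlim : Tendsto (fun n => ψ (u n) / ρ (u n)) atTop (𝓝 0)) :
    logExponent ρ ψ u ∈ Icc (0 : ℝ) 1 := by
  have h := eventually_logQuotient_mem_Icc hlu hρ hψ hlim
  have hbdd : IsBoundedUnder (· ≤ ·) atTop
      fun n => Real.log (ρ (u n)) / Real.log (ψ (u n)) := ⟨1, by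
    rw [eventually_map]
    exact h.mono fun n hn => hn.2.2⟩
  have hcob : IsCoboundedUnder (· ≤ ·) atTop
      fun n => Real.log (ρ (u n)) / Real.log (ψ (u n)) :=
    IsBoundedUnder.isCoboundedUnder_le ⟨0, by
      rw [eventually_map]
      exact h.mono fun n hn => hn.2.1⟩
  exact ⟨le_limsup_of_frequently_le (h.mono fun n hn => hn.2.1).frequently hbdd,
    limsup_le_of_le hcob (h.mono fun n hn => hn.2.2)⟩

theorem frequently_le_rpow_of_lt_logExponent (hlu : IsLowerUpper l u) (hρ : IsUbiquityFunction ρ)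
    (hψ : IsApproximatingFunction ψ)
    (hlim : Tendsto (fun n => ψ (u n) / ρ (u n)) atTop (𝓝 0)) {τ : ℝ}
    (hτ : τ < logExponent ρ ψ u) : ∃ᶠ n in atTop, ρ (u n) ≤ ψ (u n) ^ τ := by
  have h := eventually_logQuotient_mem_Icc hlu hρ hψ hlim
  have hcob : IsCoboundedUnder (· ≤ ·) atTop
      fun n => Real.log (ρ (u n)) / Real.log (ψ (u n)) :=
    IsBoundedUnder.isCoboundedUnder_le ⟨0, by
      rw [eventually_map]
      exact h.mono fun n hn => hn.2.1⟩
  refine ((frequently_lt_of_lt_limsup hcob hτ).and_eventually h).mono fun n hn => ?_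
  have hp := hρ.pos _ (hlu.upper_pos n)
  have hψn := hψ.pos _ (hlu.upper_pos n)
  have hlog : Real.log (ψ (u n)) < 0 := Real.log_neg hψn hn.2.1
  have h1 := (lt_div_iff_of_neg hlog).1 hn.1
  rw [← Real.log_le_log_iff hp (Real.rpow_pos_of_pos hψn τ), Real.log_rpow hψn]
  exact h1.le

theorem exists_frequently_le_of_liminf_lt_top (hlu : IsLowerUpper l u)
    (hψ : IsApproximatingFunction ψ) {σ : ℝ}
    (h : liminf (fun n => ENNReal.ofReal (ρ (u n) / ψ (u n) ^ σ)) atTop < ⊤) :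
    ∃ C > 0, ∃ᶠ n in atTop, ρ (u n) ≤ C * ψ (u n) ^ σ := by
  obtain ⟨B, hB, hBtop⟩ := exists_between h
  refine ⟨B.toReal + 1, by positivity, (frequently_lt_of_liminf_lt (by isBoundedDefault) hB).mono
    fun n hn => ?_⟩
  have hψn := Real.rpow_pos_of_pos (hψ.pos _ (hlu.upper_pos n)) σ
  rw [← div_le_iff₀ hψn]
  have := (ENNReal.ofReal_le_iff_le_toReal hBtop.ne).1 hn.le
  linarith

end Exponent

theorem ofReal_le_dimH_of_hausdorffMeasure_eq_top {Ω : Type*} [MetricSpace Ω] [MeasurableSpace Ω]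
    [BorelSpace Ω] {A : Set Ω} {s : ℝ} (hs : 0 ≤ s) (h : Measure.hausdorffMeasure s A = ⊤) :
    ENNReal.ofReal s ≤ dimH A := by
  lift s to ℝ≥0 using hs
  rw [ENNReal.ofReal_coe_nnreal]
  exact le_dimH_of_hausdorffMeasure_eq_top h

end Ubiquity

/-! ### The two cases of the theorem -/

open Ubiquity in
theorem corollary5 {Ω : Type*} [MetricSpace Ω] [CompactSpace Ω] [MeasurableSpace Ω] [BorelSpace Ω]
    (m : Measure Ω) [IsProbabilityMeasure m] [NullSingletonClass m]
    {J : Type*} [Countable J] [Infinite J]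
    (R : J → Set Ω) (β : J → ℝ) (hβ : Ubiquity.IsWeight β)
    (l u : ℕ → ℝ) (hlu : Ubiquity.IsLowerUpper l u)
    (ρ ψ : ℝ → ℝ) (hρ : Ubiquity.IsUbiquityFunction ρ) (hψ : Ubiquity.IsApproximatingFunction ψ)
    (δ γ : ℝ) (hM2 : Ubiquity.ConditionM2 m δ)
    (hub : Ubiquity.IsLocallyUbiquitous m R β ρ l u γ) :
    (δ ≠ γ → Tendsto (fun n => ψ (u n) / ρ (u n)) atTop (𝓝 0) →
      ENNReal.ofReal (γ + Ubiquity.logExponent ρ ψ u * (δ - γ)) ≤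
          dimH (Ubiquity.limsupSet R β ψ) ∧
        (liminf (fun n => ENNReal.ofReal
            (ρ (u n) / ψ (u n) ^ Ubiquity.logExponent ρ ψ u)) atTop < ⊤ →
          Measure.hausdorffMeasure (γ + Ubiquity.logExponent ρ ψ u * (δ - γ))
            (Ubiquity.limsupSet R β ψ) = ⊤)) ∧
    ((δ = γ ∨ 0 < limsup (fun n => ENNReal.ofReal (ψ (u n) / ρ (u n))) atTop) →
      0 < Measure.hausdorffMeasure δ (Ubiquity.limsupSet R β ψ) ∧
        Measure.hausdorffMeasure δ (Ubiquity.limsupSet R β ψ) < ⊤ ∧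
        dimH (Ubiquity.limsupSet R β ψ) = ENNReal.ofReal δ) := by
  obtain ⟨a, b, hm⟩ := hM2.exists_regularMeasure
  have hδ := hm.exp_pos
  have hγ : 0 ≤ γ := hub.2.1
  have hγδ : γ ≤ δ :=
    (ENNReal.ofReal_le_ofReal_iff hδ.le).1 (hub.2.2.1.trans hm.dimH_univ_le)
  refine ⟨fun hne hlim => ?_, fun hor => ?_⟩
  · have hlt : γ < δ := lt_of_le_of_ne hγδ hne.symm
    obtain ⟨hσ0, hσ1⟩ := logExponent_mem_Icc hlu hρ hψ hlim
    set σ := logExponent ρ ψ u with hσ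
    have htop : liminf (fun n => ENNReal.ofReal (ρ (u n) / ψ (u n) ^ σ)) atTop < ⊤ →
        Measure.hausdorffMeasure (γ + σ * (δ - γ)) (limsupSet R β ψ) = ⊤ := by
      intro hfin
      obtain ⟨C, hC, hfreq⟩ := exists_frequently_le_of_liminf_lt_top hlu hψ hfin
      refine hub.hausdorffMeasure_eq_top hm hβ hlu hρ hψ hlt hlim hσ0 ?_ hC hfreq
      -- The growth argument needs `γ + σ (δ - γ) < δ`. If `σ = 1`, then `ρ(u_n) ≤ C ψ(u_n)`
      -- infinitely often, against `ψ(u_n) / ρ(u_n) → 0`.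
      refine lt_of_le_of_ne hσ1 fun h1 => ?_
      rw [h1] at hfreq
      obtain ⟨n, hn1, hn2⟩ := (hfreq.and_eventually
        (hlim.eventually (gt_mem_nhds (inv_pos.2 hC)))).exists
      have hp := hρ.pos _ (hlu.upper_pos n)
      rw [Real.rpow_one] at hn1
      rw [div_lt_iff₀ hp, ← div_eq_inv_mul, lt_div_iff₀ hC] at hn2
      linarith
    refine ⟨?_, htop⟩
    -- For `σ > 0` the bound follows by letting `τ` increase to `σ` through nonnegative exponents.
    -- For `σ = 0` there are none below, but `τ = 0` itself works, since eventually `ρ(u_n) < 1`.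
    rcases hσ0.eq_or_lt with h0 | h0
    · refine ofReal_le_dimH_of_hausdorffMeasure_eq_top (by positivity) ?_
      have hρ1 : ∀ᶠ n in atTop, ρ (u n) < 1 :=
        (hρ.tendsto_zero.comp hlu.upper_tendsto).eventually (gt_mem_nhds one_pos)
      rw [← h0]
      refine hub.hausdorffMeasure_eq_top hm hβ hlu hρ hψ hlt hlim le_rfl one_pos one_pos ?_
      exact (hρ1.mono fun n hn => by simpa using hn.le).frequently
    · have hcont : Tendsto (fun x : ℝ => ENNReal.ofReal (γ + x * (δ - γ))) (𝓝[<] σ)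
          (𝓝 (ENNReal.ofReal (γ + σ * (δ - γ)))) := by
        have : Continuous fun x : ℝ => ENNReal.ofReal (γ + x * (δ - γ)) :=
          ENNReal.continuous_ofReal.comp (by fun_prop)
        exact this.continuousAt.tendsto.mono_left nhdsWithin_le_nhds
      refine le_of_tendsto hcont ?_
      filter_upwards [Ioo_mem_nhdsLT h0] with τ hτ
      have hτδ : 0 ≤ τ * (δ - γ) := mul_nonneg hτ.1.le (by linarith)
      refine ofReal_le_dimH_of_hausdorffMeasure_eq_top (by positivity) ?_
      refine hub.hausdorffMeasure_eq_top hm hβ hlu hρ hψ hlt hlim hτ.1.le (hτ.2.trans_le hσ1)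
        one_pos ?_
      simpa using frequently_le_rpow_of_lt_logExponent hlu hρ hψ hlim hτ.2
  · have hpos : 0 < m (limsupSet R β ψ) := by
      rcases hor with rfl | hls
      · refine hub.measure_limsupSet_pos hm hβ hlu hρ hψ one_pos (Frequently.of_forall fun n => ?_)
        have hp := hρ.pos _ (hlu.upper_pos n)
        have hψn := hψ.pos _ (hlu.upper_pos n)
        -- With `δ = γ` the exponent vanishes, so the comparison holds for any admissible thickness.
        exact ⟨min (ρ (u n)) (ψ (u n)), lt_min hp hψn, min_le_left _ _, min_le_right _ _, by simp⟩
      · obtain ⟨B, hB0, hB⟩ := exists_between hls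
        have hBtop : B ≠ ⊤ := hB.ne_top
        -- Capping the ratio at `1` keeps the thickness `min B 1 * ρ(u_n)` below `ρ(u_n)` as well as
        -- `ψ(u_n)`.
        have hη : 0 < min B.toReal 1 := lt_min (ENNReal.toReal_pos hB0.ne' hBtop) one_pos
        refine hub.measure_limsupSet_pos hm hβ hlu hρ hψ (c₀ := min B.toReal 1 ^ (δ - γ))
          (by positivity)
          ((frequently_lt_of_lt_limsup (by isBoundedDefault) hB).mono fun n hn => ?_)
        have hp := hρ.pos _ (hlu.upper_pos n)
        refine ⟨min B.toReal 1 * ρ (u n), by positivity,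
          mul_le_of_le_one_left hp.le (min_le_right _ _), ?_, (Real.mul_rpow hη.le hp.le).ge⟩
        rw [← le_div_iff₀ hp]
        exact (min_le_left _ _).trans ((ENNReal.lt_ofReal_iff_toReal_lt hBtop).1 hn).le
    have h1 := hm.hausdorffMeasure_pos hpos
    have h2 := (measure_mono (subset_univ (limsupSet R β ψ))).trans_lt hm.hausdorffMeasure_univ_lt_top
    refine ⟨h1, h2, ?_⟩
    lift δ to ℝ≥0 using hδ.le
    rw [ENNReal.ofReal_coe_nnreal]
    exact dimH_of_hausdorffMeasure_ne_zero_ne_top h1.ne' h2.ne
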